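/- **Setting.** Let $H$ be a binary matrix; its rows are called check nodes, its columns variable nodes, and a check node and a variable node are neighbors if the corresponding entry of $H$ is $1$. A set $A$ of variable nodes is an *absorption set* if for every $v\in A$ more than half of the check nodes neighboring $v$ have an even number of neighbors in $A$. It is an *$(a,b)$ absorption set* if moreover $|A|=a$ and exactly $b$ check nodes have an odd number of neighbors in $A$. Let $G$ be a graph. We say that $A$ *has topology $G$* if every check node has at most two neighbors in $A$, and there is a bijection from $A$ to the vertices of $G$ such that two distinct elements of $A$ have exactly one common neighboring check node if the corresponding vertices are adjacent in $G$, and none otherwise. **The code.** Let $\mathrm{GF}(64)=\mathbb F_2[\alpha]/(\alpha^6+\alpha+1)$. The $(2048,1723)$ regular $(6,32)$ LDPC code of the IEEE 802.3an standard has the $384\times 2048$ parity-check matrix $\mathbf H=(\sigma_{ij})_{1\le i\le 6,\,1\le j\le 32}$, where $\sigma_{ij}$ is the $64\times 64$ permutation matrix, with rows and columns indexed by $\mathrm{GF}(64)$, whose entry in position $(x,y)$ is $1$ if and only if $x=y+d_{ij}$. Here $d_{ij}=0$ if $i=1$ or $j=1$, and $d_{ij}=\alpha^{\,i-2+e_j}$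 otherwise, with $$(e_2,\dots,e_{32})=(42,10,28,58,11,16,25,20,40,23,33,39,62,2,56,37,48,45,3,41,35,36,5,46,7,27,30,32,54,4,0).$$ The check nodes and the variable nodes may be numbered in any order (the rows and the columns of $\mathbf H$ may be permuted arbitrarily). **Theorem.** The matrix $\mathbf H$ has exactly $14{,}272$ $(8,8)$ absorption sets, and all of them have the topology $G$, where $G$ is the $5$-regular graph on the vertices $0,1,\dots,7$ with the $20$ edges $$01,\,02,\,03,\,04,\,05,\,12,\,13,\,14,\,15,\,24,\,26,\,27,\,35,\,36,\,37,\,46,\,47,\,56,\,57,\,67,$$ that is, the complement of the two disjoint $4$-cycles $0\,6\,1\,7$ and $2\,3\,4\,5$. -/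

import Mathlib

/-! ## Absorption sets of a parity-check matrix -/

/-- The number of times the check node `c` is connected to the set `A` of variable nodes, in the
Tanner graph of the binary matrix `H` (rows are check nodes, columns are variable nodes). -/
def connections {C V : Type*} (H : Matrix C V (ZMod 2)) (A : Finset V) (c : C) : ℕ :=
  (A.filter (fun v => H c v = 1)).card

/-- The check nodes that neighbor the variable node `v`. -/
def neighborChecks {C V : Type*} [Fintype C] (H : Matrix C V (ZMod 2)) (v : V) : Finset C :=
  Finset.univ.filter (fun c => H c v = 1)

/-- `A` is an absorption set: for each variable node in `A`, a (strict) majority of its neighboring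
check nodes is connected to `A` an even number of times. -/
def IsAbsorptionSet {C V : Type*} [Fintype C] (H : Matrix C V (ZMod 2)) (A : Finset V) : Prop :=
  ∀ v ∈ A, (neighborChecks H v).card <
    2 * ((neighborChecks H v).filter (fun c => Even (connections H A c))).card

/-- The extrinsic message degree: the number of check nodes connected to `A` an odd number of
times, that is, of unsatisfied checks. -/
def extrinsicMessageDegree {C V : Type*} [Fintype C] (H : Matrix C V (ZMod 2)) (A : Finset V) : ℕ :=
  (Finset.univ.filter (fun c => Odd (connections H A c))).card

/-- `A` is an `(a, b)` absorption set. -/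
def IsABAbsorptionSet {C V : Type*} [Fintype C] (H : Matrix C V (ZMod 2)) (a b : ℕ)
    (A : Finset V) : Prop :=
  IsAbsorptionSet H A ∧ A.card = a ∧ extrinsicMessageDegree H A = b

/-- `A` has the topology `G` (check nodes hidden): no check node is connected to `A` more than
twice, and the variable nodes of `A` can be identified with the vertices of `G` so that two
adjacent vertices have exactly one check node in common and two distinct non-adjacent vertices
have none. Thus the edges of `G` are the checks connected twice, and every other check that meets
`A` hangs from a single variable node. -/
def HasTopology {C V W : Type*} (H : Matrix C V (ZMod 2)) (A : Finset V)
    (G : SimpleGraph W) : Prop :=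
  (∀ c, connections H A c ≤ 2) ∧
  ∃ e : {v : V // v ∈ A} ≃ W, ∀ u v : {v : V // v ∈ A}, u ≠ v →
    (G.Adj (e u) (e v) → ∃! c, H c u = 1 ∧ H c v = 1) ∧
    (¬ G.Adj (e u) (e v) → ¬ ∃ c, H c u = 1 ∧ H c v = 1)

/-! ## The parity-check matrix of the IEEE 802.3an code -/

/-- Multiplication by `α` in `GF(64) = 𝔽₂[α] / (α⁶ + α + 1)`. The element `∑ bₖ αᵏ` (`k < 6`) is
written as the natural number `∑ bₖ 2ᵏ`, so that addition is the bitwise exclusive or `^^^`. -/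
def gf64MulAlpha (x : ℕ) : ℕ :=
  if x < 32 then 2 * x else (2 * x) ^^^ 67

/-- The power `αᵏ` in `GF(64)`. -/
def gf64AlphaPow (k : ℕ) : ℕ := gf64MulAlpha^[k] 1

/-- The exponents `e j` that belong to the block columns; the entry `0` at `j = 0` is not used. -/
def blockExponent : Fin 32 → ℕ :=
  ![0, 42, 10, 28, 58, 11, 16, 25, 20, 40, 23, 33, 39, 62, 2, 56,
    37, 48, 45, 3, 41, 35, 36, 5, 46, 7, 27, 30, 32, 54, 4, 0]

/-- The element of `GF(64)` that defines the block in block row `i` and block column `j`: it is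
`0` if `i = 0` or `j = 0`, and `α ^ (i - 1 + e j)` otherwise. -/
def blockShift (i : Fin 6) (j : Fin 32) : ℕ :=
  if i = 0 ∨ j = 0 then 0 else gf64AlphaPow (i.val - 1 + blockExponent j)

/-- The `6 × 32` array of `64 × 64` permutation matrices: the block in position `(i, j)` is the
permutation matrix of the translation `y ↦ y + blockShift i j` of `GF(64)`. -/
def ieee8023anBlocks : Matrix (Fin 6 × Fin 64) (Fin 32 × Fin 64) (ZMod 2) :=
  fun c v => if c.2.val = v.2.val ^^^ blockShift c.1 v.1 then 1 else 0

/-- `H` is a parity-check matrix of the IEEE 802.3an `(2048, 1723)` code: it is the array above for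
some numbering of the `384` check nodes and of the `2048` variable nodes. -/
def IsIEEE8023anMatrix (H : Matrix (Fin 384) (Fin 2048) (ZMod 2)) : Prop :=
  ∃ (r : Fin 384 ≃ Fin 6 × Fin 64) (s : Fin 2048 ≃ Fin 32 × Fin 64),
    H = ieee8023anBlocks.submatrix r s

/-- The topology of the `(8, 8)` absorption sets: a `5`-regular graph on eight vertices, the
complement of the two disjoint `4`-cycles `0 6 1 7` and `2 3 4 5`. -/
def topology88 : SimpleGraph (Fin 8) :=
  SimpleGraph.fromEdgeSet
    {s(0, 1), s(0, 2), s(0, 3), s(0, 4), s(0, 5),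
     s(1, 2), s(1, 3), s(1, 4), s(1, 5),
     s(2, 4), s(2, 6), s(2, 7),
     s(3, 5), s(3, 6), s(3, 7),
     s(4, 6), s(4, 7),
     s(5, 6), s(5, 7),
     s(6, 7)}

/-! The shifts have the form `γ_i β_j` with distinct `γ_i` (namely `0, 1, α, …, α⁴`) and distinct
`β_j`. Hence two variable nodes share at most one check node (`eq_of_pt_eq`), and the additive group
of `GF(64)` acts on the Tanner graph by translations that preserve block rows and block columns.

Let `A` be an `(8, 8)` absorption set. Each member has at least four even checks, each of which
leads to another member, and these are distinct; so it shares no check with at most three of the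
other seven. If a check is connected `m` times, then `m (m - 1) + [m odd]` is `m`, plus a surplus of
`4` for `m = 3` and of `8` for `m = 4`; larger `m` cannot occur. Summed over all checks, this bounds
the number of pairs without a common check by `8`, by `6` if some `m = 3`, and by `4` if some `m =
4` (`Good.sum_defect_le`).

Such dense sets can be enumerated. A check connected three or four times can be translated to index
`0`; its members miss at most one element each, and an exhaustive search around it finds nothing
(`Good.mult_zero_le_two`), so no check is connected more than twice. Next, a translation makes the
least element of `A` equal to `64 * j`. This element lies in a triangle (`Good.exists_triangle`),
which is extended by one element at a time; by averaging, some remaining element misses few of those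
already chosen (`exists_mem_extend`). The kernel evaluates the search and tests each set found for
the absorption property, for the topology, and for having at most two elements in column `j`.

The number of sets follows by double counting pairs of a set and one of its elements in its least
block column, where all `64` positions contribute equally by translation (`card_goodSets`). -/

namespace AbsorptionSearch

/-! ## Evaluation-friendly primitives

The search below is evaluated by the kernel, so it is written with recursors and with the operations
on natural numbers that the kernel computes natively. A set of variable nodes is a natural number
whose binary digits mark its elements, and the variable node in column `y` of block column `j` is
the number `64 * j + y`. -/

/-- `f n`, where `n` is evaluated before it is handed to `f`. -/
def force {α : Type} (n : ℕ) (f : ℕ → α) : α :=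
  Nat.rec (motive := fun _ => α) (f 0) (fun m _ => f (Nat.succ m)) n

/-- `a` if `n = 0`, and `b` otherwise. -/
def ite0 {α : Type} (n : ℕ) (a b : α) : α :=
  Nat.rec (motive := fun _ => α) a (fun _ _ => b) n

/-- `f a`, with the value `a` shared. -/
def share {α : Type} (a : ℕ) (f : ℕ → α) : α := f a

/-- Concatenation of lists. -/
def app {α : Type} (l m : List α) : List α :=
  List.rec (motive := fun _ => List α) m (fun a _ ih => a :: ih) l

/-- The difference of two sets. -/
def sdiffN (a b : ℕ) : ℕ := Nat.xor a (Nat.land a b)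

/-- The singleton of `u`. -/
def single (u : ℕ) : ℕ := Nat.shiftLeft 1 u

/-- The set of the elements of a list. -/
def bits (l : List ℕ) : ℕ :=
  List.rec (motive := fun _ => ℕ) 0 (fun u _ ih => Nat.lor (single u) ih) l

/-- The set of all variable nodes. -/
def ones : ℕ := Nat.sub (single 2048) 1

/-- The block shifts, six binary digits each. -/
def shiftTable : ℕ :=
  0x40cfd69258f462fd9919a55de43237b0eb51e3ca21254c80206f8b4b3c1a3366ed0cdaeff6013a587de971e53194a6401037e427860d19bb37827d36fd009d2e2eb538f2b9cc5b400a0b9295c3270ec5ba43269bf8806f91177b1e617de23dc00505c9cce1b28162dd21936c7c48764a9bfc8938ff730e80000000000000000000000000000000000000000000000000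

/-- The block shift in block row `x` and block column `j`. -/
def sh (x j : ℕ) : ℕ :=
  Nat.land (Nat.shiftRight shiftTable (Nat.mul 6 (Nat.add (Nat.mul 32 x) j))) 63

/-- The check node of block row `x` that neighbors the variable node `v`. -/
def pt (x v : ℕ) : ℕ := Nat.xor (Nat.land v 63) (sh x (Nat.shiftRight v 6))

/-- The variable nodes that neighbor the check node `z` of block row `x`. -/
def line (x z : ℕ) : ℕ :=
  Nat.rec (motive := fun _ => ℕ) 0
    (fun j acc => Nat.lor acc (single (Nat.add (Nat.mul 64 j) (Nat.xor z (sh x j))))) 32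

/-- The lines of the six check nodes that neighbor `u`. -/
def lines (u : ℕ) : List ℕ :=
  [force (pt 0 u) (line 0), force (pt 1 u) (line 1), force (pt 2 u) (line 2),
    force (pt 3 u) (line 3), force (pt 4 u) (line 4), force (pt 5 u) (line 5)]

/-- The variable nodes other than `u` that share a check node with `u`. -/
def nbr (u : ℕ) : ℕ :=
  sdiffN (List.rec (motive := fun _ => ℕ) 0 (fun p _ ih => Nat.lor p ih) (lines u)) (single u)

/-- The discrete logarithms to the base `2` modulo the prime `2053`, eleven binary digits each. -/
def logTable : ℕ :=
  0x4028072720200b93a9f202d360185de4f1be4fa29603116a6f8d006b162f0f624fc1837f7413f55214c1aa03a1122fa269c7b7c6a9600708362e364bc93f7b2cba500f68326c0e0427ba36113feceaa685c53e010d6ec2045cb4240cc8c472d14d369cab8f712cb1b7f54b391407e6a1085898c5231b57b0bd0c52800e1ed10465e8f6508f01eeaae0d2043639c4e0f23850776e9305b0a135400fdd9ff96aa2f2431e50546f0c0447436021763c5204973b9835509cae0687648cf608e7d9345bc869dcde9d15b572643dcb96967e1b1ba4afed1dd2d2e0c8d30408252cd715842e1e2c71718cf7ea49da06db3cbdaa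48bdab118c684a0ef8073a6dedbc020ba3d9844a47dcae511111e39947c156558e920d8cd40af30d9490ce5430e13a9e48b0214be73bd39ae9ee860cd4ac36d609da9d40d4c1fcb6b682d1fcc22eaa8455e7ced0cedff2bf1c54c20de3c1301d0323cfc0369fc0454f9d914de2b6f6054992e98c6e6e861ac6b50a03095e57c1aaa83b5f888d0d2ec26363a453eca67b46662792af5a7ad7e71c069de2e2b86295d187323893dd34572e6525a757f0ea7b1c20a49789ffbf0b8f07c92ddf95c3ef723ae9984b1c08a774a6d23361d48aee7c431a8c3ee68b20e78bb1018d3d1efe65e92de3ed3dd06e07b67b2def77ec526e30be530565d686382a3445a4a1062df3e281d6c5d38bedee1b7782a8483325d202ed98b0e8978ed1ffaee591a251bfe224834795c7ccc3b07c96f2ae9395690d74b5220e49519d8a90327379b4b0d9bfa923feb39891a1b5bce1ffe755c3b92db758318a1512c7d11eceffd19cf6a2ea677dd27d583e0a6a7d16c3a2adae97827cd2d510c141095a9b7f07f81c5b7117689485a4b93f3fa9119336ab51108df017a6b1e78de90d652dc192bcb55bf90d7055573842bb3794fde0ac7f024f0a093148fa667e3ae0371c73fab2811cf6a7f20dd9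e1129c0538b516b7c4ca058009349e8ba8a3c64f5ae7068d0e9586bb2c35d6090abae062d2e586432c17a81b23b5539bced84bfc7e488df121a675fb173531de123acbf8a916bb329033fa6746f29cc6e89e550a57d391a86a55b02279cfc5e04fba9e5bbc5e6acaefe03166715deff311888c929cc4a7c3ddac568ce75cc43e32bdca5ab8aeb059fc42f953e2e71cc664163a926546c514abfc56de191823cda63e7d0d2e42ebf510d714cbf7cde32435a5d4c7661eb6591204091304f0f512a5806937a336f903abe0a2c69774138843bec35266b101ee737dc0b28b71d14a22f741882dd98dc7f7a579bc04e0331dba93374bc9db3b5369eeadac6e9e30f9ddd9f125970db6f7d9bfda37d4a37f71a794befd5a621f959f1eeb7de464040056d00d185d2d449ca1ceb0c72eb7d568f16dbc1df9ed8d7c74ea1f5f9675eedac371fbde148a54438483fa364ca5b48857178e05995d861ee3e2626cc7879d2074cf5e5ff96e578d3f5e5267b7ff4cc89c1541c20079ecbb90ad7338c21dbc807d6ed2e1d74ac24749fded573bd21c329d36e5a9210a0e9f992c0b467e5fc56d0903df64e8695e7078a5a17cda30b7f65b2493f7ff64a73a2271245168764fae13b4e260effe195d5a38e1f2f3936a2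b71bf1613878c75aa15b5725be35f48b48f8dc4f0598fa40f67479bb53e82eaf49cf1b23753ba3ed7cd84224c17a7daa595e8c886c458b456bfb6c6be4bf67c2858e9a6f7f54d608636b941a2e12c6eaa713bbfbfc48030103af116e33888d233696db292a9169f535ca38ff46c1f5442446fcd99de96aba62a24ca023a8cf82a617ada2d65a4f9eb656f61650d853ca62fb70874c96e0fcbd91ab8cd3e4b616bb76855cd6ae8c461151e5dae4779be29fd13b835de6409bb02eac9e38fa82c3998c7a4905634ce909f90afd73d3837c34391ec4ff618596604125b19efcbea04da909965da286c251aca79cd02bf678ba31a2f29adfd782679f6060990010064d80a4f74d4bb1bd14845719b157af05ee7d510d2843447b64ae2086c13e65a3d4d7c26b07b350b60075f72819471698ade58ff4c899a4b0d22bd63101b9034783bd55203ce1c88ee3040983f3f22f1f27bbc8e020e265c86a4ad3b1d7fb1bc7e6c568c7b95f0a9263b2df9809462ae1d8b7df7b3b3b522ac0d06f7d34eff47449e5444332155746331e5c8fa16ea15fbe69cbb9da8ed5d4d52d6cad01141139d6def8d07f81d027de7ee9e94cb79263186853580bcaf2a7fc2344c645233b9855e2d6e018b4c4986c46d10c9f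5653a8271370a3e37e3de2e858c9d9a39d373c69dcc8e687ef40cb5e2ee61ea5b7eb7174bfac8292d0187c4ec45f46d950324174c371d7ad8ceff5065c61d65b92690ca8f25314a72a56fe7fc890addff786db68c24ae3d7d0b4f9d8fa609e888a52ecd185e252fd81b88851d71fa8999443dfeb06f394724d5a6b75c975cfc63d3be62265d6e71964cf590584009d152620013c8a27aa19d2ab2bb02eb5a5642bd28eb3704af23c44eb734f072fa2ca8fd31ca1d0d099c7a90447c47db6e8d57df337bfb10a9b3deb11ce43dee2e24b32f817119474d45a535b22fda5e850b6214ca6eed658e6b59004bde9d7fbcfe3fc0e969c2faccc9edede2da93f406eb1faf2cdfedadcfb5b686d478bbb1246d96686f37e3c9f503ef1def00fd9f85c24d3aa5cd676dde76f821eb396aff74891c1e894a85670175dc726b3cdd2cbf656fad9ea994140ffb295a0c1e3fbb3ae246ef4ef064ee40827e01665e6837d4d20770bcc28b5bf6250898a264e9d983432237977a877db86ad2d5bc60b36e165c1e79af3fd2363bb9be488f4f5944416297eebdb3d635ef55fb5a8b4dc93afe0c01e1b37917b6951f521c5b00847ccf4898593a8b52f687493640b01485e87370564199b60bb33558851d7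20f8626ddd4dbaaf1ec383d1589208aee9b0cfd86173016c3974d9cb0a16351ccfb08c252d77cf826200009a686f08a31482d54107fb51024f47a425d997fee4c7056dfcf3452118640877202e42c0c7daf0ddc07cb8cacebcf18acb94490b792861cef8ce957ef677d12087954197239d3be5dcdb52a52cf087b760f5013f452e4be8405ca9868451cc0b5716185687d5504709beeb9d3a9d234c395e7de10f3faa970280c1b0cdab23619eb1fe5c52da42e49a717f023ffe5b5255f3f3ae084513404981a28de9e87eafca1566b8cfb9dc990e2cf4c1f450000a10ccca9d66414721278873397aa3b93d08d47f0edcfdedfaa6961c3c710bde32544ad7692164c96b1ad09757ef1da55f51ec16bcfe3ecde6e4d9cf0923b32df7e9f1c07c16e74d66f38876d5488f42156eb26ae959573cc13d9230375a45777b8cfbe5dbe81d984bf544b93706236d40e15aa8b2b2de67a3bb844564ec4ebcb19579161395fecdb6cf51d7ff2d3028ab40d8c28872b1ed7e6a51c7c177355437ac22b619616b5f361421cb45f5d84b808376c4ea7fb4279092ff46ffe548080a01604bbc0f4ab78ae4d6ee1b673bd62395391af9369acedb9400a568354b1416a184ea9c21731d11c9783f4827d84c8bd5dc42149c0475b4f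9d81e67819f4dabaac4fa4c73ce898a06539002473251b41fe17dd5330ed7b543b4732359d7dd287af9f4dd6cc489be71b0b55950e4870a89a72a41217e9137165c0eafd3262357082c7cc3b7b25aeeae93866bd43e52896c41c5af51bbb70d8566159ae72aba807625ece11c6ea3e801774aa72586b7a1527c6b367fe8289e60f839d0bbe09990dc34df6cf03018d5b3e67909fc7fcc6837dc87550a63d7c3d537090f1aac92193441148796df9a34160edb5d137e9ea203851a86b850e4806f651b4ffca9c325456668130473c12dc2b6405e7c09ee61f6ea0d7b9b7c6642c10cb48cdda93650f467098058d92a0a868039d7040b09dfb55eb8c40f4644d68c00494f9fee009caf30389a003cfc26e0680213400400000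

/-- The exponent `u < 2048` of the power `2 ^ u`. -/
def bitIndex (b : ℕ) : ℕ :=
  force (Nat.mod b 2053) fun r => Nat.land (Nat.shiftRight logTable (Nat.mul 11 r)) 2047

/-! ## The search -/

/-- Concatenation of the lists `f u c'` for the elements `u` of `C` in increasing order, where `c'`
is what remains of `c` when `u` and the smaller elements of `C` are removed. -/
def iter {α : Type} (fuel C c : ℕ) (f : ℕ → ℕ → List α) : List α :=
  Nat.rec (motive := fun _ => ℕ → ℕ → List α) (fun _ _ => [])
    (fun _ ih C c => ite0 C []
      (force (bitIndex (Nat.gcd C (single 2048))) fun u =>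
        app (f u (sdiffN c (single u))) (ih (Nat.sub C (single u)) (sdiffN c (single u))))) fuel C c

/-- The elements of `c` that are not on a line through `u` that meets `R`. -/
def prune (u R c : ℕ) : ℕ :=
  List.rec (motive := fun _ => ℕ → ℕ) (fun c => c)
    (fun p _ ih c => ite0 (Nat.land p R) (ih c) (ih (sdiffN c p))) (lines u) c

/-- The elements of `c` that share a check node with each member of `S` that shares none with `u`. -/
def saturate (u : ℕ) (S : List ℕ) (c : ℕ) : ℕ :=
  List.rec (motive := fun _ => ℕ → ℕ) (fun c => c)
    (fun p _ ih c => ite0 (Nat.land (nbr u) (single p)) (ih (Nat.land c (nbr p))) (ih c)) S c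

/-- The variable nodes that share a check node with all but at most `k` members of `B`. -/
def near (B : List ℕ) : ℕ → ℕ :=
  List.rec (motive := fun _ => ℕ → ℕ) (fun _ => ones)
    (fun u _ ih k => Nat.rec (motive := fun _ => ℕ) (Nat.land (ih 0) (nbr u))
      (fun k _ => Nat.lor (Nat.land (ih (Nat.succ k)) (nbr u)) (ih k)) k) B

/-- Branching over the elements of `c` in the first of the sets `Ms`, then in the second, and so on
up to the set of index `s`. -/
def levels {α : Type} (f : ℕ → ℕ → ℕ → List α) (Ms : List ℕ) : ℕ → ℕ → ℕ → List α :=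
  List.rec (motive := fun _ => ℕ → ℕ → ℕ → List α) (fun _ _ _ => [])
    (fun M _ ih k s c =>
      app (iter 2048 (Nat.land M c) c (f k))
        (ite0 s [] (ih (Nat.succ k) (Nat.pred s) (sdiffN c M)))) Ms

/-- The elements of `c` that share a check node with all but at most `s` members of `B`, if all
elements of `c` share one with all but at most three. -/
def nearIn (B : List ℕ) (s c : ℕ) : ℕ :=
  ite0 s (Nat.land (near B 0) c) (ite0 (Nat.pred s) (Nat.land (near B 1) c)
    (ite0 (Nat.pred (Nat.pred s)) (Nat.land (near B 2) c) c))

/-- All extensions of `u :: B` by `n` elements of `c` that have at most `K` pairs without a common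
check node, of which `u :: B` has `ne`. Elements on a line through a new element that meets the set
`R B` of older elements are not used, and each member of `S` shares a check node with all but one. -/
def extend (K : ℕ) (R : List ℕ → ℕ) (S : List ℕ) (n : ℕ) : ℕ → List ℕ → ℕ → ℕ → List (List ℕ) :=
  Nat.rec (motive := fun _ => ℕ → List ℕ → ℕ → ℕ → List (List ℕ))
    (fun u B _ _ => [u :: B])
    (fun n ih u B ne c =>
      -- The `n + 1` elements still to be added miss members of `u :: B` at most `K - ne` times in
      -- total, so one of them misses at most `s`.
      force (Nat.div (Nat.sub K ne) (Nat.succ n)) fun s =>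
      ite0 (nearIn (u :: B) s c) []
        (share (saturate u S (prune u (R B) c)) fun c =>
          levels (fun k w c' =>
            -- No element misses more than three others, so one that misses `w` misses at most two
            -- of `u :: B`.
            ih w (u :: B) (Nat.add ne k) (Nat.land c' (Nat.lor (nbr w) (near (u :: B) 2))))
            [near (u :: B) 0, near (u :: B) 1, near (u :: B) 2, c] 0 s c)) n

/-- All candidates for absorption sets whose least element is `64 * j`, if no check node is
connected to them more than twice. -/
def leaves (j : ℕ) : List (List ℕ) :=
  force (Nat.mul 64 j) fun v₀ =>
  share (Nat.sub ones (Nat.sub (single (Nat.succ v₀)) 1)) fun c₀ =>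
  iter 2048 (Nat.land (nbr v₀) c₀) c₀ fun v₁ c' =>
    -- `E` consists of the neighbors of `v₀` up to `v₁`. As `v₁` is to be the least element in a
    -- triangle with `v₀`, no other element of `E` that is used may be joined to `v₁` or, below, to
    -- `v₂`.
    share (Nat.xor c₀ c') fun E =>
    share (prune v₁ (single v₀)
      (sdiffN c₀ (Nat.lor (Nat.land E (nbr v₁)) (single v₁)))) fun c₁ =>
    iter 2048 (Nat.land (near [v₁, v₀] 0) c₁) c₁ fun v₂ c'' =>
      extend 8 bits [] 5 v₂ [v₁, v₀] 0 (sdiffN c'' (Nat.land E (nbr v₂)))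

/-- All candidates for sets of `n + 4` elements with at most `K` pairs without a common check node,
three of which are connected to the check node `0` of block row `x`. -/
def bundles (K n x : ℕ) : List (List ℕ) :=
  share (line x 0) fun L =>
  share (sdiffN ones L) fun c₀ =>
  iter 2048 c₀ c₀ fun q c' =>
    share (Nat.land (nbr q) L) fun M =>
    iter 2048 M M fun a Ma =>
    iter 2048 Ma Ma fun b Mb =>
    iter 2048 Mb Mb fun d _ =>
      extend K (fun _ => bits [d, b, a]) [d, b, a] n q [d, b, a] 0
        -- `q` is to be the least element off the line that is joined to three members on it, so
        -- smaller points joined to `a`, `b` and `d` are discarded.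
        (sdiffN c₀ (Nat.lor (single q) (Nat.land (Nat.xor c₀ c') (near [d, b, a] 0))))

/-! ## Tests -/

/-- The number of members of `l` that neighbor the same check node of block row `x` as `v`. -/
def occ (l : List ℕ) (v x : ℕ) : ℕ :=
  List.rec (motive := fun _ => ℕ) 0
    (fun w _ ih => ite0 (Nat.xor (pt x w) (pt x v)) (Nat.succ ih) ih) l

/-- The sum of `f x` for `x < 6`. -/
def sumRows (f : ℕ → ℕ) : ℕ :=
  Nat.add (f 0) (Nat.add (f 1) (Nat.add (f 2) (Nat.add (f 3) (Nat.add (f 4) (f 5)))))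

/-- The number of check nodes that neighbor `v` and are connected to `l` an even number of times. -/
def evens (l : List ℕ) (v : ℕ) : ℕ := sumRows fun x => Nat.sub 1 (Nat.mod (occ l v x) 2)

/-- The contribution of `v` to `105` times the number of unsatisfied checks. -/
def oddShare (l : List ℕ) (v : ℕ) : ℕ :=
  -- `105` is the least common multiple of `1, 3, 5, 7`: the `m` members at an unsatisfied check
  -- contribute `105 / m` each. Eight such checks give `840`.
  sumRows fun x => Nat.mul (Nat.mod (occ l v x) 2) (Nat.div 105 (occ l v x))

/-- The test whether the members of `l` form an `(8, 8)` absorption set. -/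
def isGood (l : List ℕ) : Bool :=
  l.all (fun v => Nat.ble 4 (evens l v)) && Nat.beq ((l.map (oddShare l)).sum) 840

/-- The test that no absorption set arises from a check node of block row `x` that is connected three
or four times. -/
def isHeavyFree (x : ℕ) : Bool :=
  (bundles 6 4 x).all (fun l => !(isGood l)) &&
    (bundles 4 3 x).all fun l =>
      -- A bundle has only three elements on the line. The fourth is added here; like the others, it
      -- misses at most one element.
      share (sdiffN (Nat.land (line x 0) (near l 1)) (bits l)) fun C =>
        (iter 2048 C C fun p _ => [p :: l]).all fun l => !(isGood l)

/-- The test whether `u` and `w` share a check node. -/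
def adjB (u w : ℕ) : Bool := !(Nat.beq (Nat.land (nbr u) (single w)) 0)

/-- The members of `l` other than `a` that share no check node with `a`. -/
def nonNbrs (l : List ℕ) (a : ℕ) : List ℕ := l.filter fun w => !(adjB a w) && !(Nat.beq a w)

/-- The adjacency matrix of `topology88`. -/
def topologyTable : ℕ := 0x7cbccbc7e3d33d3e

/-- An arrangement of `l` in the order of the vertices of `topology88`. -/
def arrange (l : List ℕ) : List ℕ :=
  -- The graph of missing pairs should be two `4`-cycles, `a b c d` and `e f g h`. Each is recovered
  -- from one vertex, its two non-neighbors and the vertex opposite.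
  let a := l.headD 0
  let b := (nonNbrs l a).headD 0
  let d := ((nonNbrs l a).drop 1).headD 0
  let c := ((nonNbrs l b).filter fun w => !(Nat.beq a w)).headD 0
  let m := l.filter fun w => !(Nat.beq w a || Nat.beq w b || Nat.beq w c || Nat.beq w d)
  let e := m.headD 0
  let f := (nonNbrs l e).headD 0
  let h := ((nonNbrs l e).drop 1).headD 0
  let g := ((nonNbrs l f).filter fun w => !(Nat.beq e w)).headD 0
  [a, c, e, f, g, h, b, d]

/-- The test whether the arrangement `o` has the topology `topology88`. -/
def isArranged (o : List ℕ) : Bool :=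
  (List.range 8).all fun i => (List.range 8).all fun k =>
    Nat.beq i k || (!(Nat.beq (o.getD i 0) (o.getD k 0)) &&
      (adjB (o.getD i 0) (o.getD k 0) == Nat.testBit topologyTable (8 * i + k)))

/-- The number of members of `l` in block column `j`. -/
def inColumn (j : ℕ) (l : List ℕ) : ℕ :=
  List.rec (motive := fun _ => ℕ) 0
    (fun w _ ih => ite0 (Nat.xor (Nat.shiftRight w 6) j) (Nat.succ ih) ih) l

/-- The test of the properties of a candidate whose least element is `64 * j`. -/
def isRooted (j : ℕ) (l : List ℕ) : Bool :=
  Nat.beq l.length 8 && isGood l && Nat.beq (bits (arrange l)) (bits l) && isArranged (arrange l) &&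
    l.all (fun v => Nat.ble (Nat.mul 64 j) v && Nat.ble v 2047) && l.any (Nat.beq (Nat.mul 64 j)) &&
    Nat.ble (inColumn j l) 2

/-- The set of the members of `l`, together with twice the reciprocal of `inColumn j l`. -/
def key (j : ℕ) (l : List ℕ) : ℕ := Nat.add (Nat.mul 4 (bits l)) (Nat.div 2 (inColumn j l))

/-- Twice the number of translation classes of absorption sets with least block column `j`. -/
def rootCount (j : ℕ) : ℕ := (((leaves j).map (key j)).dedup.map (fun a => Nat.mod a 4)).sum

/-- The values of `rootCount`. -/
def rootCounts : List ℕ :=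
  [79, 57, 69, 43, 21, 34, 15, 19, 20, 17, 17, 13, 2, 5, 11, 3, 6, 7, 1, 2, 2, 0, 1, 0, 0, 2, 0, 0,
    0, 0, 0, 0]

/-- The test of the candidates whose least element is `64 * j`. -/
def isRootChecked (j : ℕ) : Bool :=
  (leaves j).all (isRooted j) && Nat.beq (rootCount j) (rootCounts.getD j 0)

/-! ## The meaning of the primitives -/

theorem force_eq {α : Type} (n : ℕ) (f : ℕ → α) : force n f = f n := by
  cases n <;> rfl

theorem ite0_eq {α : Type} (n : ℕ) (a b : α) : ite0 n a b = if n = 0 then a else b := by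
  cases n <;> rfl

theorem app_eq {α : Type} (l m : List α) : app l m = l ++ m := by
  induction l with
  | nil => rfl
  | cons a l ih => exact congrArg (a :: ·) ih

theorem testBit_land (a b w : ℕ) : (Nat.land a b).testBit w = (a.testBit w && b.testBit w) :=
  Nat.testBit_and a b w

theorem testBit_lor (a b w : ℕ) : (Nat.lor a b).testBit w = (a.testBit w || b.testBit w) :=
  Nat.testBit_or a b w

theorem testBit_xor (a b w : ℕ) : (Nat.xor a b).testBit w = (a.testBit w ^^ b.testBit w) :=
  Nat.testBit_xor a b w

theorem single_eq (u : ℕ) : single u = 2 ^ u := by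
  change 1 <<< u = 2 ^ u
  exact Nat.one_shiftLeft u

theorem testBit_single (u w : ℕ) : (single u).testBit w = decide (u = w) := by
  rw [single_eq, Nat.testBit_two_pow]

theorem testBit_sdiffN (a b w : ℕ) : (sdiffN a b).testBit w = (a.testBit w && !b.testBit w) := by
  rw [sdiffN, testBit_xor, testBit_land]
  cases a.testBit w <;> cases b.testBit w <;> rfl

theorem testBit_bits (l : List ℕ) (w : ℕ) : (bits l).testBit w = decide (w ∈ l) := by
  induction l with
  | nil => simp [bits]
  | cons u l ih =>
    change (Nat.lor (single u) (bits l)).testBit w = _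
    rw [testBit_lor, testBit_single, ih]
    by_cases h : u = w
    · simp [h]
    · simp [h, Ne.symm h]

theorem testBit_ones (w : ℕ) : ones.testBit w = decide (w < 2048) := by
  change (single 2048 - 1).testBit w = _
  rw [single_eq, Nat.testBit_two_pow_sub_one]

theorem land_eq_zero_iff (a b : ℕ) :
    Nat.land a b = 0 ↔ ∀ w, a.testBit w = true → b.testBit w = false := by
  constructor
  · intro h w ha
    have := testBit_land a b w
    rw [h, ha, Nat.zero_testBit, Bool.true_and] at this
    exact this.symm
  · intro h
    refine Nat.eq_of_testBit_eq fun w => ?_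
    rw [testBit_land]
    cases ha : a.testBit w
    · simp
    · simp [h w ha]

theorem sh_lt (x j : ℕ) : sh x j < 64 :=
  Nat.lt_succ_of_le Nat.and_le_right

theorem pt_eq (x v : ℕ) : pt x v = (v % 64) ^^^ sh x (v / 64) := by
  change (v &&& 63) ^^^ sh x (v >>> 6) = _
  rw [show (63 : ℕ) = 2 ^ 6 - 1 from rfl, Nat.and_two_pow_sub_one_eq_mod, Nat.shiftRight_eq_div_pow]

theorem pt_lt (x v : ℕ) : pt x v < 64 := by
  rw [pt_eq]
  exact Nat.xor_lt_two_pow (n := 6) (Nat.mod_lt _ (by norm_num)) (sh_lt _ _)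

theorem testBit_line_aux (x z w : ℕ) (n : ℕ) :
    (Nat.rec (motive := fun _ => ℕ) 0
      (fun j acc => Nat.lor acc (single (Nat.add (Nat.mul 64 j) (Nat.xor z (sh x j))))) n :
        ℕ).testBit w = true ↔ ∃ j < n, 64 * j + (z ^^^ sh x j) = w := by
  induction n with
  | zero => simp
  | succ n ih =>
    change (Nat.lor _ _).testBit w = true ↔ _
    rw [testBit_lor, Bool.or_eq_true, ih, testBit_single, decide_eq_true_iff]
    constructor
    · rintro (⟨j, hj, h⟩ | h)
      · exact ⟨j, by omega, h⟩
      · exact ⟨n, by omega, h⟩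
    · rintro ⟨j, hj, h⟩
      rcases Nat.lt_succ_iff_lt_or_eq.1 hj with hj | rfl
      · exact Or.inl ⟨j, hj, h⟩
      · exact Or.inr h

theorem testBit_line (x w : ℕ) {z : ℕ} (hz : z < 64) :
    (line x z).testBit w = true ↔ w < 2048 ∧ pt x w = z := by
  rw [line, testBit_line_aux, pt_eq]
  constructor
  · rintro ⟨j, hj, rfl⟩
    have h : z ^^^ sh x j < 64 := Nat.xor_lt_two_pow (n := 6) hz (sh_lt _ _)
    refine ⟨by omega, ?_⟩
    rw [show (64 * j + (z ^^^ sh x j)) % 64 = z ^^^ sh x j by omega,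
      show (64 * j + (z ^^^ sh x j)) / 64 = j by omega, Nat.xor_assoc, Nat.xor_self, Nat.xor_zero]
  · rintro ⟨hw, rfl⟩
    refine ⟨w / 64, by omega, ?_⟩
    rw [Nat.xor_assoc, Nat.xor_self, Nat.xor_zero]
    omega

theorem testBit_line_pt (x u w : ℕ) :
    (line x (pt x u)).testBit w = true ↔ w < 2048 ∧ pt x w = pt x u :=
  testBit_line x w (pt_lt x u)

theorem mem_lines (u p : ℕ) : p ∈ lines u ↔ ∃ x < 6, p = line x (pt x u) := by
  simp only [lines, force_eq, List.mem_cons, List.not_mem_nil, or_false]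
  constructor
  · rintro (h | h | h | h | h | h)
    exacts [⟨0, by norm_num, h⟩, ⟨1, by norm_num, h⟩, ⟨2, by norm_num, h⟩, ⟨3, by norm_num, h⟩,
      ⟨4, by norm_num, h⟩, ⟨5, by norm_num, h⟩]
  · rintro ⟨x, hx, h⟩
    interval_cases x <;> simp [h]

/-! ### Adjacency of variable nodes and the sets of candidates -/

/-- The variable nodes `u` and `w` are distinct and share a check node. -/
def Adj (u w : ℕ) : Prop := u ≠ w ∧ ∃ x < 6, pt x u = pt x w

instance : DecidableRel Adj := fun u w => by unfold Adj; infer_instance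

theorem Adj.symm {u w : ℕ} (h : Adj u w) : Adj w u :=
  ⟨h.1.symm, h.2.imp fun _ h => ⟨h.1, h.2.symm⟩⟩

theorem adj_comm {u w : ℕ} : Adj u w ↔ Adj w u := ⟨Adj.symm, Adj.symm⟩

theorem testBit_foldLor (l : List ℕ) (w : ℕ) :
    (List.rec (motive := fun _ => ℕ) 0 (fun p _ ih => Nat.lor p ih) l : ℕ).testBit w = true ↔
      ∃ p ∈ l, p.testBit w = true := by
  induction l with
  | nil => simp
  | cons p l ih =>
    change (Nat.lor p _).testBit w = true ↔ _
    rw [testBit_lor, Bool.or_eq_true, ih]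
    simp

theorem testBit_nbr (u w : ℕ) : (nbr u).testBit w = true ↔ w < 2048 ∧ Adj u w := by
  rw [nbr, testBit_sdiffN, Bool.and_eq_true, testBit_foldLor, testBit_single]
  simp only [mem_lines, Bool.not_eq_true', decide_eq_false_iff_not]
  constructor
  · rintro ⟨⟨p, ⟨x, hx, rfl⟩, hp⟩, hne⟩
    rw [testBit_line_pt] at hp
    exact ⟨hp.1, hne, x, hx, hp.2.symm⟩
  · rintro ⟨hw, hne, x, hx, h⟩
    exact ⟨⟨_, ⟨x, hx, rfl⟩, (testBit_line_pt x u w).2 ⟨hw, h.symm⟩⟩, hne⟩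

theorem testBit_prune_aux (R w : ℕ) (l : List ℕ) (c : ℕ) :
    ((List.rec (motive := fun _ => ℕ → ℕ) (fun c => c)
      (fun p _ ih c => ite0 (Nat.land p R) (ih c) (ih (sdiffN c p))) l : ℕ → ℕ) c).testBit w = true ↔
      c.testBit w = true ∧ ∀ p ∈ l, p.testBit w = true → Nat.land p R = 0 := by
  induction l generalizing c with
  | nil => simp
  | cons p l ih =>
    change (ite0 (Nat.land p R) _ _ : ℕ).testBit w = true ↔ _
    rw [ite0_eq]
    split_ifs with h
    · rw [ih]
      simp only [List.mem_cons, forall_eq_or_imp, h, imp_true_iff, true_and]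
    · rw [ih, testBit_sdiffN]
      simp only [Bool.and_eq_true, Bool.not_eq_true', List.mem_cons, forall_eq_or_imp, h,
        imp_false, Bool.not_eq_true]
      tauto

theorem testBit_prune {u R c w : ℕ} (hc : c.testBit w = true)
    (h : ∀ x < 6, ∀ r, R.testBit r = true → pt x r = pt x u → pt x w ≠ pt x u) :
    (prune u R c).testBit w = true := by
  rw [prune, testBit_prune_aux]
  refine ⟨hc, fun p hp hw => ?_⟩
  obtain ⟨x, hx, rfl⟩ := (mem_lines u p).1 hp
  rw [testBit_line_pt] at hw
  rw [land_eq_zero_iff]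
  intro r hr
  rw [testBit_line_pt] at hr
  by_contra hR
  exact h x hx r (by simpa using hR) hr.2 hw.2

theorem testBit_of_prune {u R c w : ℕ} (h : (prune u R c).testBit w = true) :
    c.testBit w = true := by
  rw [prune, testBit_prune_aux] at h
  exact h.1

theorem testBit_saturate (u w : ℕ) (S : List ℕ) (c : ℕ) :
    (saturate u S c).testBit w = true ↔ c.testBit w = true ∧
      ∀ p ∈ S, ¬(p < 2048 ∧ Adj u p) → w < 2048 ∧ Adj p w := by
  have hp (p : ℕ) : Nat.land (nbr u) (single p) = 0 ↔ ¬(p < 2048 ∧ Adj u p) := by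
    rw [← testBit_nbr, land_eq_zero_iff]
    simp only [testBit_single, decide_eq_false_iff_not]
    exact ⟨fun h h' => h p h' rfl, fun h w hw hpw => h (hpw ▸ hw)⟩
  unfold saturate
  induction S generalizing c with
  | nil => simp
  | cons p S ih =>
    change (ite0 (Nat.land (nbr u) (single p)) _ _ : ℕ).testBit w = true ↔ _
    rw [ite0_eq]
    split_ifs with h
    · refine (ih _).trans ?_
      rw [testBit_land, Bool.and_eq_true, testBit_nbr]
      rw [hp] at h
      simp only [List.mem_cons, forall_eq_or_imp, h, not_false_eq_true, true_imp_iff]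
      tauto
    · refine (ih _).trans ?_
      rw [hp] at h
      simp only [List.mem_cons, forall_eq_or_imp, h, false_imp_iff, true_and]

/-- The number of members of `B` that share no check node with `w`. -/
def miss (w : ℕ) (B : List ℕ) : ℕ := B.countP fun b => ¬ Adj w b

theorem miss_cons (w u : ℕ) (B : List ℕ) :
    miss w (u :: B) = miss w B + if Adj w u then 0 else 1 := by
  rw [miss, List.countP_cons, ← miss]
  by_cases h : Adj w u <;> simp [h]

theorem near_cons_zero (u : ℕ) (B : List ℕ) : near (u :: B) 0 = Nat.land (near B 0) (nbr u) := rfl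

theorem near_cons_succ (u : ℕ) (B : List ℕ) (k : ℕ) :
    near (u :: B) (k + 1) = Nat.lor (Nat.land (near B (k + 1)) (nbr u)) (near B k) := rfl

theorem testBit_near (B : List ℕ) (k w : ℕ) :
    (near B k).testBit w = true ↔ w < 2048 ∧ miss w B ≤ k := by
  induction B generalizing k with
  | nil =>
    change ones.testBit w = true ↔ _
    simp [testBit_ones, miss]
  | cons u B ih =>
    rw [miss_cons]
    cases k with
    | zero =>
      rw [near_cons_zero, testBit_land, Bool.and_eq_true, ih, testBit_nbr, adj_comm]
      by_cases h : Adj w u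
      · simp only [h, and_true, if_true, add_zero]
        tauto
      · simp [h]
    | succ k =>
      rw [near_cons_succ, testBit_lor, testBit_land, Bool.or_eq_true, Bool.and_eq_true, ih, ih,
        testBit_nbr, adj_comm]
      by_cases h : Adj w u
      · simp only [h, and_true, if_true, add_zero]
        constructor
        · rintro (h | h)
          exacts [h.1, ⟨h.1, by omega⟩]
        · exact fun h => Or.inl ⟨h, h.1⟩
      · simp [h]

/-- `2` is a primitive root modulo `2053`, so the residues of these powers are distinct and a table
of logarithms recovers the exponent. -/
theorem bitIndex_two_pow {u : ℕ} (hu : u < 2048) : bitIndex (2 ^ u) = u := by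
  have h : (List.range 2048).all fun u => Nat.beq (bitIndex (Nat.pow 2 u)) u := by
    decide +kernel
  exact Nat.eq_of_beq_eq_true (List.all_eq_true.1 h u (List.mem_range.2 hu))

/-! ## Completeness of the search -/

/-- The gcd with a high power of two isolates the lowest binary digit of `C`, and subtracting it
deletes the least element. -/
theorem gcd_two_pow_eq {C : ℕ} (hC : C ≠ 0) (h : ∀ w, C.testBit w = true → w < 2048) :
    ∃ u < 2048, Nat.gcd C (single 2048) = 2 ^ u ∧ C.testBit u = true ∧
      (∀ w < u, C.testBit w = false) ∧
      ∀ w, (C - 2 ^ u).testBit w = true ↔ C.testBit w = true ∧ w ≠ u := by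
  obtain ⟨u, m, ⟨k, rfl⟩, rfl⟩ := Nat.exists_eq_two_pow_mul_odd hC
  have hu : (2 ^ u * (2 * k + 1)).testBit u = true := by
    rw [Nat.testBit_two_pow_mul]
    simp
  refine ⟨u, h u hu, ?_, hu, fun w hw => ?_, fun w => ?_⟩
  · rw [single_eq, show 2048 = u + (2048 - u) by have := h u hu; omega, pow_add,
      Nat.gcd_mul_left]
    have : Nat.Coprime (2 * k + 1) (2 ^ (2048 - u)) := by
      apply Nat.Coprime.pow_right
      simp
    rw [this.gcd_eq_one, mul_one]
  · rw [Nat.testBit_two_pow_mul]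
    simp [hw]
  · rw [show 2 ^ u * (2 * k + 1) - 2 ^ u = 2 ^ u * (2 * k) by rw [Nat.mul_succ, Nat.add_sub_cancel],
      Nat.testBit_two_pow_mul, Nat.testBit_two_pow_mul]
    rcases lt_trichotomy w u with hw | rfl | hw
    · simp [show ¬ u ≤ w by omega]
    · simp
    · obtain ⟨i, rfl⟩ := Nat.exists_eq_add_of_lt hw
      have e : u + i + 1 - u = i + 1 := by omega
      simp [e, Nat.testBit_succ, show (2 * k + 1) / 2 = k by omega, show u ≤ u + i + 1 by omega,
        show u + i + 1 ≠ u by omega]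

/-- The branch of `u` has lost only elements of `C` up to `u`. If `u` is the least element of a
target set within `C`, the rest of the target is still available. -/
theorem exists_subset_iter {α : Type} {C : ℕ} (c : ℕ) (f : ℕ → ℕ → List α)
    (hC : ∀ w, C.testBit w = true → w < 2048) {u : ℕ} (hu : C.testBit u = true) :
    ∃ c', (∀ w, c'.testBit w = true ↔ c.testBit w = true ∧ ¬(C.testBit w = true ∧ w ≤ u)) ∧
      f u c' ⊆ iter 2048 C c f := by
  -- The fuel suffices because all elements of `C` are at least `2048 - fuel`: each step removes the
  -- least one.
  suffices H : ∀ (fuel C c : ℕ), (∀ w, C.testBit w = true → 2048 ≤ w + fuel ∧ w < 2048) →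
      ∀ u, C.testBit u = true →
      ∃ c', (∀ w, c'.testBit w = true ↔ c.testBit w = true ∧ ¬(C.testBit w = true ∧ w ≤ u)) ∧
        f u c' ⊆ iter fuel C c f from
    H 2048 C c (fun w hw => ⟨by omega, hC w hw⟩) u hu
  clear hu u hC c C
  intro fuel
  induction fuel with
  | zero => intro C c hC u hu; have := hC u hu; omega
  | succ n ih =>
    intro C c hC u hu
    have hC0 : C ≠ 0 := by rintro rfl; simp at hu
    obtain ⟨b, hb, hgcd, hCb, hlow, hsub⟩ := gcd_two_pow_eq hC0 fun w hw => (hC w hw).2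
    have e : iter (n + 1) C c f = f b (sdiffN c (single b)) ++
        iter n (C - 2 ^ b) (sdiffN c (single b)) f := by
      change ite0 C [] (force (bitIndex (Nat.gcd C (single 2048))) _) = _
      rw [ite0_eq, if_neg hC0, hgcd, bitIndex_two_pow hb, force_eq, app_eq, ← single_eq]
      rfl
    rw [e]
    have hbu : b ≤ u := by
      by_contra! h
      simp [hlow u h] at hu
    rcases hbu.eq_or_lt with rfl | hlt
    · refine ⟨_, fun w => ?_, List.subset_append_left _ _⟩
      rw [testBit_sdiffN, testBit_single, Bool.and_eq_true, Bool.not_eq_true',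
        decide_eq_false_iff_not]
      refine and_congr_right fun _ => not_congr ⟨?_, fun h => ?_⟩
      · rintro rfl
        exact ⟨hCb, le_rfl⟩
      · by_contra hne
        have := hlow w (lt_of_le_of_ne h.2 (Ne.symm hne))
        rw [h.1] at this
        cases this
    · obtain ⟨c', hc', hf⟩ := ih (C - 2 ^ b) (sdiffN c (single b)) (fun w hw => by
        obtain ⟨h1, h2⟩ := (hsub w).1 hw
        have := hC w h1
        have := hC b hCb
        have : b < w := by
          by_contra! h3
          have := hlow w (lt_of_le_of_ne h3 h2)
          rw [h1] at this
          cases this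
        omega) u ((hsub u).2 ⟨hu, hlt.ne'⟩)
      refine ⟨c', fun w => ?_, List.Subset.trans hf (List.subset_append_right _ _)⟩
      rw [hc', hsub, testBit_sdiffN, testBit_single, Bool.and_eq_true, Bool.not_eq_true',
        decide_eq_false_iff_not]
      constructor
      · rintro ⟨⟨h1, h2⟩, h3⟩
        exact ⟨h1, fun h4 => h3 ⟨⟨h4.1, Ne.symm h2⟩, h4.2⟩⟩
      · rintro ⟨h1, h2⟩
        refine ⟨⟨h1, ?_⟩, fun h4 => h2 ⟨h4.1.1, h4.2⟩⟩
        rintro rfl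
        exact h2 ⟨hCb, hlt.le⟩

/-- `W` is the unknown set of elements still to be added, and `d` counts what each one misses. The
branch to follow takes the least value of `d` on `W` and the least element attaining it; everything
discarded earlier lies outside `W`. -/
theorem exists_subset_levels {α : Type} (f : ℕ → ℕ → ℕ → List α) (W : Finset ℕ) (d : ℕ → ℕ)
    (Ms : List ℕ) (k s c : ℕ) (hc : ∀ w, c.testBit w = true → w < 2048)
    (hW : ∀ w ∈ W, c.testBit w = true)
    (hM : ∀ i (hi : i < Ms.length), ∀ w ∈ W, Ms[i].testBit w = true ↔ d w ≤ k + i)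
    (hk : ∀ w ∈ W, k ≤ d w) (hex : ∃ w ∈ W, d w ≤ k + s ∧ d w < k + Ms.length) :
    ∃ u ∈ W, ∃ c', (∀ w ∈ W, w ≠ u → c'.testBit w = true) ∧
      (∀ w, c'.testBit w = true → w < 2048) ∧ f (d u) u c' ⊆ levels f Ms k s c := by
  induction Ms generalizing k s c with
  | nil =>
    obtain ⟨w, hw, -, h⟩ := hex
    have := hk w hw
    simp only [List.length_nil] at h
    omega
  | cons M Ms ih =>
    have e : levels f (M :: Ms) k s c = iter 2048 (Nat.land M c) c (f k) ++
        if s = 0 then [] else levels f Ms (k + 1) (s - 1) (sdiffN c M) := by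
      change app _ (ite0 s [] _) = _
      rw [app_eq, ite0_eq]
      rfl
    rw [e]
    have hM0 : ∀ w ∈ W, M.testBit w = true ↔ d w ≤ k := fun w hw => hM 0 (by simp) w hw
    by_cases h : ∃ w ∈ W, d w = k
    · have hne : (W.filter fun w => d w = k).Nonempty := by
        obtain ⟨w, hw, h⟩ := h
        exact ⟨w, Finset.mem_filter.2 ⟨hw, h⟩⟩
      obtain ⟨huW, hu⟩ := Finset.mem_filter.1 (Finset.min'_mem _ hne)
      set u := (W.filter fun w => d w = k).min' hne with hudef
      obtain ⟨c', hc', hf⟩ := exists_subset_iter (C := Nat.land M c) c (f k)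
        (fun w hw => hc w (by rw [testBit_land, Bool.and_eq_true] at hw; exact hw.2)) (u := u)
        (by rw [testBit_land, Bool.and_eq_true]; exact ⟨(hM0 u huW).2 hu.le, hW u huW⟩)
      refine ⟨u, huW, c', fun w hw hwu => (hc' w).2 ⟨hW w hw, fun h => hwu ?_⟩,
        fun w hw => hc w ((hc' w).1 hw).1, ?_⟩
      · rw [testBit_land, Bool.and_eq_true] at h
        have h1 : d w = k := le_antisymm ((hM0 w hw).1 h.1.1) (hk w hw)
        exact le_antisymm h.2 (Finset.min'_le _ _ (Finset.mem_filter.2 ⟨hw, h1⟩))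
      · rw [hu]
        exact List.Subset.trans hf (List.subset_append_left _ _)
    · push Not at h
      have hk' : ∀ w ∈ W, k + 1 ≤ d w := fun w hw => lt_of_le_of_ne (hk w hw) (h w hw).symm
      obtain ⟨w₀, hw₀, h1, h2⟩ := hex
      have hs : s ≠ 0 := by
        have := hk' w₀ hw₀
        omega
      obtain ⟨u, hu, c', h3, h4, h5⟩ := ih (k + 1) (s - 1) (sdiffN c M)
        (fun w hw => hc w (by rw [testBit_sdiffN, Bool.and_eq_true] at hw; exact hw.1))
        (fun w hw => by
          rw [testBit_sdiffN, Bool.and_eq_true, Bool.not_eq_true']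
          refine ⟨hW w hw, ?_⟩
          have := mt (hM0 w hw).1 (by have := hk' w hw; omega)
          simpa using this)
        (fun i hi w hw => by
          rw [show k + 1 + i = k + (i + 1) by omega]
          exact hM (i + 1) (by simpa using hi) w hw)
        hk' ⟨w₀, hw₀, by omega, by simp only [List.length_cons] at h2; omega⟩
      refine ⟨u, hu, c', h3, h4, ?_⟩
      rw [if_neg hs]
      exact List.Subset.trans h5 (List.subset_append_right _ _)

/-! ### Pairs without a common check node -/

/-- The number of elements of `D` other than `v` that share no check node with `v`. -/
def defect (D : Finset ℕ) (v : ℕ) : ℕ := (D.filter fun w => v ≠ w ∧ ¬ Adj v w).card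

/-- The number of pairs of members of the list that share no check node. -/
def pairDefect : List ℕ → ℕ
  | [] => 0
  | u :: B => pairDefect B + miss u B

theorem defect_union {D E : Finset ℕ} (h : Disjoint D E) (v : ℕ) :
    defect (D ∪ E) v = defect D v + defect E v := by
  rw [defect, Finset.filter_union, Finset.card_union_of_disjoint]
  · rfl
  · exact Finset.disjoint_filter_filter h

theorem defect_mono {D E : Finset ℕ} (h : D ⊆ E) (v : ℕ) : defect D v ≤ defect E v :=
  Finset.card_le_card (Finset.filter_subset_filter _ h)

theorem sum_defect_comm (D E : Finset ℕ) : ∑ v ∈ D, defect E v = ∑ v ∈ E, defect D v := by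
  simp only [defect, Finset.card_filter]
  rw [Finset.sum_comm]
  refine Finset.sum_congr rfl fun v _ => Finset.sum_congr rfl fun w _ => ?_
  simp only [adj_comm (u := w), ne_comm (a := w)]

theorem defect_toFinset {B : List ℕ} (hB : B.Nodup) {w : ℕ} (hw : w ∉ B) :
    defect B.toFinset w = miss w B := by
  rw [defect, miss, List.countP_eq_length_filter, ← List.toFinset_card_of_nodup (hB.filter _)]
  congr 1
  ext v
  simp only [Finset.mem_filter, List.mem_toFinset, List.mem_filter, decide_eq_true_eq]
  refine and_congr_right fun hv => and_iff_right ?_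
  rintro rfl
  exact hw hv

theorem sum_defect_toFinset {B : List ℕ} (hB : B.Nodup) :
    ∑ v ∈ B.toFinset, defect B.toFinset v = 2 * pairDefect B := by
  induction B with
  | nil => simp [pairDefect]
  | cons u B ih =>
    obtain ⟨hu, hB'⟩ := List.nodup_cons.1 hB
    have hd : Disjoint ({u} : Finset ℕ) B.toFinset := by simpa using hu
    have e : (u :: B).toFinset = {u} ∪ B.toFinset := by simp
    have h1 : defect {u} u = 0 := by simp [defect]
    rw [e, Finset.sum_union hd]
    simp only [defect_union hd, Finset.sum_add_distrib, Finset.sum_singleton, h1]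
    rw [ih hB', ← sum_defect_comm {u}, Finset.sum_singleton, defect_toFinset hB' hu, pairDefect]
    ring

theorem testBit_nearIn {B : List ℕ} {s c w : ℕ} (hw : w < 2048) (hc : c.testBit w = true)
    (hs : miss w B ≤ s) : (nearIn B s c).testBit w = true := by
  have h (k : ℕ) (hk : miss w B ≤ k) : (Nat.land (near B k) c).testBit w = true := by
    rw [testBit_land, Bool.and_eq_true, testBit_near]
    exact ⟨⟨hw, hk⟩, hc⟩
  rw [nearIn, ite0_eq, ite0_eq, ite0_eq, Nat.pred_eq_sub_one, Nat.pred_eq_sub_one]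
  split_ifs
  exacts [h 0 (by omega), h 1 (by omega), h 2 (by omega), hc]

/-- Induction on the number of missing elements, with the invariant that the list lies in `D` and
the candidates contain the rest of `D`. Each cut respects it: `hR` justifies pruning, `hS` (members
of `S` miss at most one element) justifies saturation, and `h3` bounds the misses of later elements.
-/
theorem exists_mem_extend {D : Finset ℕ} (hD : ∀ v ∈ D, v < 2048) {K : ℕ}
    (hK : ∑ v ∈ D, defect D v ≤ 2 * K) (h3 : ∀ v ∈ D, defect D v ≤ 3) {S B₀ : List ℕ}
    (hS : ∀ p ∈ S, ∀ u ∈ D, ∀ w ∈ D, u ≠ w → u ≠ p → w ≠ p → Adj p u ∨ Adj p w)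
    (hSD : ∀ p ∈ S, p ∈ D) (hSB : S ⊆ B₀) {R : List ℕ → ℕ}
    (hR : ∀ B, B₀ ⊆ B → (∀ v ∈ B, v ∈ D) → ∀ u ∈ D, u ∉ B → ∀ w ∈ D, w ∉ B → w ≠ u →
      ∀ x < 6, ∀ r, (R B).testBit r = true → pt x r = pt x u → pt x w ≠ pt x u)
    (n u : ℕ) (B : List ℕ) (c : ℕ) (hB : (u :: B).Nodup) (hBD : ∀ v ∈ u :: B, v ∈ D)
    (hB₀ : B₀ ⊆ B) (hcard : D.card = (u :: B).length + n)
    (hc : ∀ w, c.testBit w = true → w < 2048) (hDc : ∀ w ∈ D, w ∉ u :: B → c.testBit w = true) :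
    ∃ l ∈ extend K R S n u B (pairDefect (u :: B)) c, l.Nodup ∧ l.toFinset = D := by
  induction n generalizing u B c with
  | zero =>
    refine ⟨u :: B, List.mem_singleton.2 rfl, hB, Finset.eq_of_subset_of_card_le ?_ ?_⟩
    · exact fun v hv => hBD v (List.mem_toFinset.1 hv)
    · rw [List.toFinset_card_of_nodup hB]
      omega
  | succ n ih =>
    set l := u :: B with hl
    set W := D \ l.toFinset with hWdef
    have hlD : l.toFinset ⊆ D := fun v hv => hBD v (List.mem_toFinset.1 hv)
    have hWcard : W.card = n + 1 := by
      rw [hWdef, Finset.card_sdiff_of_subset hlD, List.toFinset_card_of_nodup hB]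
      omega
    have hWmem (w : ℕ) (hw : w ∈ W) : w ∈ D ∧ w ∉ l := by
      simpa [hWdef] using hw
    have hdisj : Disjoint l.toFinset W := Finset.disjoint_sdiff
    have hunion : l.toFinset ∪ W = D := Finset.union_sdiff_of_subset hlD
    have hmiss : ∀ w ∈ W, defect l.toFinset w = miss w l := fun w hw =>
      defect_toFinset hB (hWmem w hw).2
    -- The sum of defects over `D` counts missing pairs twice, both those inside `l` and those
    -- between `l` and `W`; the pairs inside `W` are dropped.
    have hsum : pairDefect l + ∑ w ∈ W, miss w l ≤ K := by
      have h1 : ∑ v ∈ D, defect D v =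
          ∑ v ∈ l.toFinset, defect l.toFinset v + ∑ v ∈ l.toFinset, defect W v +
            (∑ v ∈ W, defect l.toFinset v + ∑ v ∈ W, defect W v) := by
        conv_lhs => rw [← hunion]
        rw [Finset.sum_union hdisj]
        simp only [defect_union hdisj, Finset.sum_add_distrib]
      rw [sum_defect_comm l.toFinset W, sum_defect_toFinset hB, Finset.sum_congr rfl hmiss] at h1
      omega
    obtain ⟨w₀, hw₀, hw₀s⟩ : ∃ w ∈ W, miss w l ≤ (K - pairDefect l) / (n + 1) := by
      by_contra! h
      have h2 : ∑ w ∈ W, ((K - pairDefect l) / (n + 1) + 1) ≤ ∑ w ∈ W, miss w l :=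
        Finset.sum_le_sum fun w hw => h w hw
      rw [Finset.sum_const, hWcard, smul_eq_mul] at h2
      have := Nat.lt_mul_div_succ (K - pairDefect l) (Nat.succ_pos n)
      rw [Nat.succ_eq_add_one] at this
      omega
    have hmiss3 (w : ℕ) (hw : w ∈ W) : miss w l ≤ 3 := by
      rw [← hmiss w hw]
      exact (defect_mono hlD w).trans (h3 w (hWmem w hw).1)
    set c₁ := saturate u S (prune u (R B) c) with hc₁
    have hc₁W (w : ℕ) (hw : w ∈ W) : c₁.testBit w = true := by
      obtain ⟨hwD, hwl⟩ := hWmem w hw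
      rw [hl, List.mem_cons, not_or] at hwl
      rw [hc₁, testBit_saturate]
      have huB : u ∉ B := (List.nodup_cons.1 hB).1
      refine ⟨testBit_prune (hDc w hwD (hWmem w hw).2) ?_, fun p hp hup => ?_⟩
      · exact hR B hB₀ (fun v hv => hBD v (List.mem_cons_of_mem _ hv)) u
          (hBD u List.mem_cons_self) huB w hwD hwl.2 hwl.1
      · have hpB := hB₀ (hSB hp)
        refine ⟨hD w hwD, ?_⟩
        have hpu : ¬ Adj p u := fun h => hup ⟨hD p (hSD p hp), h.symm⟩
        refine (hS p hp u (hBD u List.mem_cons_self) w hwD (Ne.symm hwl.1) ?_ ?_).resolve_left hpu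
        · rintro rfl
          exact huB hpB
        · rintro rfl
          exact hwl.2 hpB
    have hc₁lt (w : ℕ) (hw : c₁.testBit w = true) : w < 2048 := by
      rw [hc₁, testBit_saturate] at hw
      exact hc w (testBit_of_prune hw.1)
    have hnear : nearIn l ((K - pairDefect l) / (n + 1)) c ≠ 0 := by
      intro h
      have := testBit_nearIn (hD w₀ (hWmem w₀ hw₀).1) (hDc w₀ (hWmem w₀ hw₀).1 (hWmem w₀ hw₀).2)
        hw₀s
      rw [h] at this
      simp at this
    have e : extend K R S (n + 1) u B (pairDefect l) c = levels (fun k w c' =>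
        extend K R S n w l (pairDefect l + k) (Nat.land c' (Nat.lor (nbr w) (near l 2))))
          [near l 0, near l 1, near l 2, c₁] 0 ((K - pairDefect l) / (n + 1)) c₁ := by
      have e : extend K R S (n + 1) u B (pairDefect l) c =
          force ((K - pairDefect l) / (n + 1)) fun s => ite0 (nearIn l s c) [] (levels (fun k w c' =>
            extend K R S n w l (pairDefect l + k) (Nat.land c' (Nat.lor (nbr w) (near l 2))))
              [near l 0, near l 1, near l 2, c₁] 0 s c₁) := rfl
      rw [e, force_eq, ite0_eq, if_neg hnear]
    obtain ⟨w, hw, c', hc'W, hc'lt, hsub⟩ := exists_subset_levels (fun k w c' =>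
        extend K R S n w l (pairDefect l + k) (Nat.land c' (Nat.lor (nbr w) (near l 2))))
      W (fun w => miss w l) [near l 0, near l 1, near l 2, c₁] 0
      ((K - pairDefect l) / (n + 1)) c₁ hc₁lt hc₁W (fun i hi w hw => by
        have hw' := hD w (hWmem w hw).1
        have := hmiss3 w hw
        have := hc₁W w hw
        simp only [List.length_cons, List.length_nil] at hi
        interval_cases i
        · simp [testBit_near, hw']
        · simp [testBit_near, hw']
        · simp [testBit_near, hw']
        -- The last level admits all candidates, because no element of `W` misses more than three.
        · simp only [List.getElem_cons_succ, List.getElem_cons_zero]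
          exact ⟨fun _ => by omega, fun _ => this⟩)
      (fun _ _ => Nat.zero_le _)
      ⟨w₀, hw₀, by omega, by have := hmiss3 w₀ hw₀; simp only [List.length_cons]; omega⟩
    obtain ⟨hwD, hwl⟩ := hWmem w hw
    obtain ⟨l', hl', hres⟩ := ih w l (Nat.land c' (Nat.lor (nbr w) (near l 2)))
      (List.nodup_cons.2 ⟨hwl, hB⟩)
      (fun v hv => by
        rcases List.mem_cons.1 hv with rfl | hv
        exacts [hwD, hBD v hv])
      (List.Subset.trans hB₀ (List.subset_cons_self _ _))
      (by rw [hcard, List.length_cons (a := w)]; omega)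
      (fun v hv => by
        rw [testBit_land, Bool.and_eq_true] at hv
        exact hc'lt v hv.1)
      (fun v hvD hvl => by
        rw [List.mem_cons, not_or] at hvl
        have hvW : v ∈ W := by simpa [hWdef] using ⟨hvD, hvl.2⟩
        rw [testBit_land, testBit_lor, Bool.and_eq_true, Bool.or_eq_true, testBit_nbr, testBit_near]
        refine ⟨hc'W v hvW hvl.1, ?_⟩
        by_cases h : Adj w v
        · exact Or.inl ⟨hD v hvD, h⟩
        · have h1 : defect (w :: l).toFinset v = miss v (w :: l) :=
            defect_toFinset (List.nodup_cons.2 ⟨hwl, hB⟩)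
              (by rw [List.mem_cons, not_or]; exact hvl)
          have h2 : (w :: l).toFinset ⊆ D := by
            intro y hy
            rcases List.mem_cons.1 (List.mem_toFinset.1 hy) with rfl | hy
            exacts [hwD, hBD y hy]
          have h4 := (defect_mono h2 v).trans (h3 v hvD)
          rw [h1, miss_cons, if_neg (mt Adj.symm h)] at h4
          exact Or.inr ⟨hD v hvD, by omega⟩)
    refine ⟨l', ?_, hres⟩
    rw [e]
    exact hsub hl'

/-! ## Absorption sets with eight elements and eight unsatisfied checks -/

/-- The number of times that the check node `z` of block row `x` is connected to `A`. -/
def mult (A : Finset ℕ) (x z : ℕ) : ℕ := (A.filter fun v => pt x v = z).card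

/-- `A` is an `(8, 8)` absorption set. -/
def Good (A : Finset ℕ) : Prop :=
  (∀ v ∈ A, v < 2048) ∧ A.card = 8 ∧
    (∀ v ∈ A, 4 ≤ ((Finset.range 6).filter fun x => Even (mult A x (pt x v))).card) ∧
    ∑ x ∈ Finset.range 6, ((Finset.range 64).filter fun z => Odd (mult A x z)).card = 8

/-- With shifts `γ_x β_j` the equation reads `(γ_x - γ_y)(β_j - β_k) = 0`, and both families have
distinct terms. Here it is checked by enumeration. -/
theorem sh_injective {x y j k : ℕ} (hy : y < 6) (hj : j < 32) (hk : k < 32)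
    (hxy : x < y) (h : sh x j ^^^ sh x k = sh y j ^^^ sh y k) : j = k := by
  have key : (List.range 6).all fun y => (List.range y).all fun x => (List.range 32).all fun k =>
      (List.range k).all fun j =>
        !(Nat.beq (Nat.xor (sh x j) (sh x k)) (Nat.xor (sh y j) (sh y k))) := by
    decide +kernel
  simp only [List.all_eq_true, List.mem_range] at key
  rcases lt_trichotomy j k with hjk | hjk | hjk
  · have := key y hy x hxy k hk j hjk
    rw [show Nat.xor (sh x j) (sh x k) = Nat.xor (sh y j) (sh y k) from h, Nat.beq_refl] at this
    cases this
  · exact hjk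
  · have := key y hy x hxy j hj k hjk
    rw [show Nat.xor (sh x k) (sh x j) = Nat.xor (sh y k) (sh y j) from by
      change sh x k ^^^ sh x j = sh y k ^^^ sh y j
      rw [Nat.xor_comm, h, Nat.xor_comm], Nat.beq_refl] at this
    cases this

/-- The Tanner graph has no `4`-cycle: two common checks would equate differences of shifts in two
block rows, which forces one block column and then one position. -/
theorem eq_of_pt_eq {u v x y : ℕ} (hu : u < 2048) (hv : v < 2048) (hx : x < 6) (hy : y < 6)
    (huv : u ≠ v) (h₁ : pt x u = pt x v) (h₂ : pt y u = pt y v) : x = y := by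
  by_contra hxy
  rw [pt_eq, pt_eq] at h₁ h₂
  have key (x : ℕ) (h : u % 64 ^^^ sh x (u / 64) = v % 64 ^^^ sh x (v / 64)) :
      sh x (u / 64) ^^^ sh x (v / 64) = u % 64 ^^^ v % 64 := by
    have e : sh x (v / 64) = v % 64 ^^^ (u % 64 ^^^ sh x (u / 64)) := by
      rw [h, ← Nat.xor_assoc, Nat.xor_self, Nat.zero_xor]
    rw [e, Nat.xor_comm, Nat.xor_assoc, Nat.xor_assoc, Nat.xor_self, Nat.xor_zero, Nat.xor_comm]
  have h3 := (key x h₁).trans (key y h₂).symm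
  have hj : u / 64 = v / 64 := by
    rcases Nat.lt_or_gt_of_ne hxy with h | h
    · exact sh_injective hy (by omega) (by omega) h h3
    · exact sh_injective hx (by omega) (by omega) h h3.symm
  have h4 : u % 64 = v % 64 := by
    rw [hj] at h₁
    exact Nat.xor_left_injective h₁
  omega

theorem sum_mult (A : Finset ℕ) (x : ℕ) (f : ℕ → ℕ) :
    ∑ v ∈ A, f (mult A x (pt x v)) = ∑ z ∈ Finset.range 64, mult A x z * f (mult A x z) := by
  rw [← Finset.sum_fiberwise_of_maps_to (g := pt x) (t := Finset.range 64)
    fun v _ => Finset.mem_range.2 (pt_lt x v)]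
  refine Finset.sum_congr rfl fun z _ => ?_
  rw [Finset.sum_congr rfl (g := fun _ => f (mult A x z)) fun v hv => by
    rw [(Finset.mem_filter.1 hv).2], Finset.sum_const, smul_eq_mul]
  rfl

theorem mult_le_card (A : Finset ℕ) (x z : ℕ) : mult A x z ≤ A.card :=
  Finset.card_filter_le _ _

theorem mult_pos {A : Finset ℕ} {v : ℕ} (hv : v ∈ A) (x : ℕ) : 0 < mult A x (pt x v) :=
  Finset.card_pos.2 ⟨v, Finset.mem_filter.2 ⟨hv, rfl⟩⟩

/-- The number of elements of `A` that share a check node with `v`. -/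
def degree (A : Finset ℕ) (v : ℕ) : ℕ := (A.filter (Adj v)).card

theorem degree_add_defect {A : Finset ℕ} {v : ℕ} (hv : v ∈ A) :
    degree A v + defect A v + 1 = A.card := by
  have e : defect A v = ((A.erase v).filter fun w => ¬ Adj v w).card := by
    rw [defect]
    congr 1
    ext w
    simp only [Finset.mem_filter, Finset.mem_erase, ne_comm (a := v)]
    tauto
  have e' : degree A v = ((A.erase v).filter (Adj v)).card := by
    rw [degree]
    congr 1
    ext w
    simp only [Finset.mem_filter, Finset.mem_erase]
    exact ⟨fun h => ⟨⟨h.2.1.symm, h.1⟩, h.2⟩, fun h => ⟨h.1.2, h.2⟩⟩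
  rw [e, e', Finset.card_filter_add_card_filter_not, Finset.card_erase_add_one hv]

/-- Neighbors reached through different checks are distinct, since two nodes share at most one
check. -/
theorem degree_eq_sum {A : Finset ℕ} (hA : ∀ v ∈ A, v < 2048) {v : ℕ} (hv : v ∈ A) :
    degree A v = ∑ x ∈ Finset.range 6, (mult A x (pt x v) - 1) := by
  have e : A.filter (Adj v) =
      (Finset.range 6).biUnion fun x => (A.filter fun w => pt x w = pt x v).erase v := by
    ext w
    simp only [Finset.mem_filter, Finset.mem_biUnion, Finset.mem_range, Finset.mem_erase, Adj]
    constructor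
    · rintro ⟨hw, hne, x, hx, h⟩
      exact ⟨x, hx, hne.symm, hw, h.symm⟩
    · rintro ⟨x, hx, hne, hw, h⟩
      exact ⟨hw, hne.symm, x, hx, h.symm⟩
  rw [degree, e, Finset.card_biUnion]
  · refine Finset.sum_congr rfl fun x _ => ?_
    have : v ∈ A.filter fun w => pt x w = pt x v := Finset.mem_filter.2 ⟨hv, rfl⟩
    rw [Finset.card_erase_of_mem this]
    rfl
  · intro x hx y hy hxy
    refine Finset.disjoint_left.2 ?_
    intro w hwx hwy
    simp only [Finset.mem_erase, Finset.mem_filter] at hwx hwy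
    exact hxy (eq_of_pt_eq (hA w hwx.2.1) (hA v hv) (Finset.mem_range.1 hx) (Finset.mem_range.1 hy)
      hwx.1 hwx.2.2 hwy.2.2)

theorem even_card_eq_sum (m : ℕ → ℕ) :
    ((Finset.range 6).filter fun x => Even (m x)).card =
      ∑ x ∈ Finset.range 6, if Even (m x) then 1 else 0 := Finset.card_filter _ _

/-- Each even check supplies at least one neighbor, and `e` records what the checks supply beyond
that. -/
theorem four_le_sum {m : ℕ → ℕ}
    (heven : 4 ≤ ((Finset.range 6).filter fun x => Even (m x)).card) (e : ℕ → ℕ)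
    (he : ∀ x < 6, e x + (if Even (m x) then 1 else 0) ≤ m x - 1) :
    4 + ∑ x ∈ Finset.range 6, e x ≤ ∑ x ∈ Finset.range 6, (m x - 1) := by
  rw [even_card_eq_sum] at heven
  have := Finset.sum_le_sum fun x hx => he x (Finset.mem_range.1 hx)
  rw [Finset.sum_add_distrib] at this
  omega

theorem even_le {m : ℕ} (hm : 0 < m) : (if Even m then 1 else 0) ≤ m - 1 := by
  split_ifs with h
  · obtain ⟨k, rfl⟩ := h
    omega
  · omega

theorem add_even_le {m : ℕ} (hm : 3 ≤ m) : 2 + (if Even m then 1 else 0) ≤ m - 1 := by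
  split_ifs with h
  · obtain ⟨k, rfl⟩ := h
    omega
  · omega

namespace Good

variable {A : Finset ℕ} (hA : Good A)
include hA

theorem four_add_le {v : ℕ} (hv : v ∈ A) (e : ℕ → ℕ)
    (he : ∀ x < 6, e x + (if Even (mult A x (pt x v)) then 1 else 0) ≤ mult A x (pt x v) - 1) :
    4 + ∑ x ∈ Finset.range 6, e x ≤ degree A v := by
  rw [degree_eq_sum hA.1 hv]
  exact four_le_sum (hA.2.2.1 v hv) e he

theorem degree_le {v : ℕ} (hv : v ∈ A) : degree A v ≤ 7 := by
  have := degree_add_defect hv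
  have := hA.2.1
  omega

theorem defect_le_three {v : ℕ} (hv : v ∈ A) : defect A v ≤ 3 := by
  have h1 := hA.four_add_le hv (fun _ => 0) fun x _ => by simpa using even_le (mult_pos hv x)
  have := degree_add_defect hv
  have := hA.2.1
  simp only [Finset.sum_const_zero] at h1
  omega

/-- A check connected at least three times supplies two neighbors beyond the minimum, so `v` has at
least six among the seven other elements. -/
theorem defect_le_one {v x : ℕ} (hv : v ∈ A) (hx : x < 6) (h : 3 ≤ mult A x (pt x v)) :
    defect A v ≤ 1 := by
  have h1 := hA.four_add_le hv (fun y => if y = x then 2 else 0) fun y _ => by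
    split_ifs with h1 h2 h2
    · subst h1; simpa [h2] using add_even_le h
    · subst h1; simpa [h2] using add_even_le h
    · simpa [h2] using even_le (mult_pos hv y)
    · omega
  rw [Finset.sum_ite_eq' (Finset.range 6) x, if_pos (Finset.mem_range.2 hx)] at h1
  have := degree_add_defect hv
  have := hA.2.1
  omega

/-- Two such checks at `v` would give it `4 + 2 + 2` neighbors among seven elements. -/
theorem eq_of_three_le_mult {v x y : ℕ} (hv : v ∈ A) (hx : x < 6) (hy : y < 6)
    (h₁ : 3 ≤ mult A x (pt x v)) (h₂ : 3 ≤ mult A y (pt y v)) : x = y := by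
  by_contra hxy
  have h1 := hA.four_add_le hv (fun i => (if i = x then 2 else 0) + if i = y then 2 else 0)
    fun i _ => by
      by_cases hix : i = x
      · subst hix
        simpa [hxy] using add_even_le h₁
      by_cases hiy : i = y
      · subst hiy
        simpa [hix] using add_even_le h₂
      simpa [hix, hiy] using even_le (mult_pos hv i)
  rw [Finset.sum_add_distrib, Finset.sum_ite_eq' (Finset.range 6) x,
    Finset.sum_ite_eq' (Finset.range 6) y, if_pos (Finset.mem_range.2 hx),
    if_pos (Finset.mem_range.2 hy)] at h1
  have := hA.degree_le hv
  omega

/-- A check connected five times or more has surplus at least `4`, which again requires eight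
neighbors. -/
theorem mult_le_four {x : ℕ} (hx : x < 6) (z : ℕ) : mult A x z ≤ 4 := by
  by_contra! h
  obtain ⟨v, hv, rfl⟩ : ∃ v ∈ A, pt x v = z := by
    obtain ⟨v, hv⟩ := Finset.card_pos.1 (show 0 < mult A x z by omega)
    exact ⟨v, Finset.mem_filter.1 hv⟩
  have h1 := hA.four_add_le hv (fun y => if y = x then 4 else 0) fun y _ => by
    by_cases hyx : y = x
    · subst hyx
      simp only [if_true]
      split_ifs with h2
      · obtain ⟨k, hk⟩ := h2
        omega
      · omega
    · simpa [hyx] using even_le (mult_pos hv y)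
  rw [Finset.sum_ite_eq' (Finset.range 6) x, if_pos (Finset.mem_range.2 hx)] at h1
  have := hA.degree_le hv
  omega

theorem sum_defect_le {x₀ z₀ : ℕ} (hx₀ : x₀ < 6) (hz₀ : z₀ < 64) :
    ∑ v ∈ A, defect A v +
      (if mult A x₀ z₀ = 3 then 4 else if 4 ≤ mult A x₀ z₀ then 8 else 0) ≤ 16 := by
  set ex : ℕ → ℕ := fun m => if m = 3 then 4 else if 4 ≤ m then 8 else 0 with hex
  change _ + ex (mult A x₀ z₀) ≤ 16
  have h1 : ∑ v ∈ A, degree A v + ∑ v ∈ A, defect A v + 8 = 64 := by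
    have := Finset.sum_congr rfl fun v (hv : v ∈ A) => degree_add_defect hv
    rw [Finset.sum_add_distrib, Finset.sum_add_distrib, Finset.sum_const, Finset.sum_const,
      hA.2.1] at this
    simpa using this
  have h2 : ∑ v ∈ A, degree A v = ∑ x ∈ Finset.range 6, ∑ z ∈ Finset.range 64,
      mult A x z * (mult A x z - 1) := by
    rw [Finset.sum_congr rfl fun v hv => degree_eq_sum hA.1 hv, Finset.sum_comm]
    exact Finset.sum_congr rfl fun x _ => sum_mult A x fun m => m - 1
  -- Eight variable nodes of degree six have `48` incidences with checks.
  have h3 : ∑ x ∈ Finset.range 6, ∑ z ∈ Finset.range 64, mult A x z = 48 := by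
    rw [Finset.sum_congr rfl (g := fun _ => 8) fun x _ => ?_]
    · simp
    · have := sum_mult A x fun _ => 1
      simp only [Finset.sum_const, hA.2.1, mul_one, smul_eq_mul] at this
      exact this.symm
  have h4 := hA.2.2.2
  -- Termwise, the two sides agree for every multiplicity from `0` to `4`; `ex` is the surplus over
  -- the count with multiplicities at most two.
  have h5 : ∑ x ∈ Finset.range 6, ∑ z ∈ Finset.range 64, (mult A x z + ex (mult A x z)) ≤
      ∑ x ∈ Finset.range 6, ∑ z ∈ Finset.range 64,
        (mult A x z * (mult A x z - 1) + if Odd (mult A x z) then 1 else 0) := by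
    refine Finset.sum_le_sum fun x hx => Finset.sum_le_sum fun z _ => ?_
    have := hA.mult_le_four (Finset.mem_range.1 hx) z
    generalize mult A x z = m at this
    interval_cases m <;> simp [hex] <;> decide
  have h6 : ex (mult A x₀ z₀) ≤ ∑ x ∈ Finset.range 6, ∑ z ∈ Finset.range 64, ex (mult A x z) :=
    (Finset.single_le_sum (f := fun z => ex (mult A x₀ z)) (fun _ _ => Nat.zero_le _)
      (Finset.mem_range.2 hz₀)).trans
      (Finset.single_le_sum (f := fun x => ∑ z ∈ Finset.range 64, ex (mult A x z))
        (fun _ _ => Nat.zero_le _) (Finset.mem_range.2 hx₀))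
  simp only [Finset.card_filter] at h4
  simp only [Finset.sum_add_distrib] at h5
  omega

end Good

/-! ## Evaluation of the search -/

theorem isHeavyFree_zero : isHeavyFree 0 = true := by decide +kernel

theorem isHeavyFree_one : isHeavyFree 1 = true := by decide +kernel

theorem isHeavyFree_two : isHeavyFree 2 = true := by decide +kernel

theorem isHeavyFree_three : isHeavyFree 3 = true := by decide +kernel

theorem isHeavyFree_four : isHeavyFree 4 = true := by decide +kernel

theorem isHeavyFree_five : isHeavyFree 5 = true := by decide +kernel

theorem isRootChecked_of_range'_0 : (List.range' 0 1).all isRootChecked = true := by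
  decide +kernel

theorem isRootChecked_of_range'_1 : (List.range' 1 1).all isRootChecked = true := by
  decide +kernel

theorem isRootChecked_of_range'_2 : (List.range' 2 1).all isRootChecked = true := by
  decide +kernel

theorem isRootChecked_of_range'_3 : (List.range' 3 1).all isRootChecked = true := by
  decide +kernel

theorem isRootChecked_of_range'_4 : (List.range' 4 1).all isRootChecked = true := by
  decide +kernel

theorem isRootChecked_of_range'_5 : (List.range' 5 1).all isRootChecked = true := by
  decide +kernel

theorem isRootChecked_of_range'_6 : (List.range' 6 2).all isRootChecked = true := by
  decide +kernel

theorem isRootChecked_of_range'_8 : (List.range' 8 2).all isRootChecked = true := by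
  decide +kernel

theorem isRootChecked_of_range'_10 : (List.range' 10 4).all isRootChecked = true := by
  decide +kernel

theorem isRootChecked_of_range'_14 : (List.range' 14 18).all isRootChecked = true := by
  decide +kernel

theorem isHeavyFree_of_lt {x : ℕ} (hx : x < 6) : isHeavyFree x = true := by
  interval_cases x
  exacts [isHeavyFree_zero, isHeavyFree_one, isHeavyFree_two, isHeavyFree_three, isHeavyFree_four,
    isHeavyFree_five]

theorem isRootChecked_of_lt {j : ℕ} (hj : j < 32) : isRootChecked j = true := by
  have key (a n : ℕ) (h : (List.range' a n).all isRootChecked = true) (h₁ : a ≤ j)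
      (h₂ : j < a + n) : isRootChecked j = true :=
    List.all_eq_true.1 h j (List.mem_range'_1.2 ⟨h₁, h₂⟩)
  by_cases h0 : j < 1
  · exact key 0 1 isRootChecked_of_range'_0 (by omega) (by omega)
  by_cases h1 : j < 2
  · exact key 1 1 isRootChecked_of_range'_1 (by omega) (by omega)
  by_cases h2 : j < 3
  · exact key 2 1 isRootChecked_of_range'_2 (by omega) (by omega)
  by_cases h3 : j < 4
  · exact key 3 1 isRootChecked_of_range'_3 (by omega) (by omega)
  by_cases h4 : j < 5
  · exact key 4 1 isRootChecked_of_range'_4 (by omega) (by omega)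
  by_cases h5 : j < 6
  · exact key 5 1 isRootChecked_of_range'_5 (by omega) (by omega)
  by_cases h6 : j < 8
  · exact key 6 2 isRootChecked_of_range'_6 (by omega) (by omega)
  by_cases h8 : j < 10
  · exact key 8 2 isRootChecked_of_range'_8 (by omega) (by omega)
  by_cases h10 : j < 14
  · exact key 10 4 isRootChecked_of_range'_10 (by omega) (by omega)
  exact key 14 18 isRootChecked_of_range'_14 (by omega) (by omega)

/-! ## Translations -/

theorem xor_div_sixtyfour {v t : ℕ} (ht : t < 64) : (v ^^^ t) / 64 = v / 64 := by
  have := Nat.shiftRight_xor_distrib (a := v) (b := t) (i := 6)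
  simp only [Nat.shiftRight_eq_div_pow] at this
  rw [show (64 : ℕ) = 2 ^ 6 from rfl, this, Nat.div_eq_of_lt (a := t) ht, Nat.xor_zero]

theorem xor_mod_sixtyfour {v t : ℕ} (ht : t < 64) : (v ^^^ t) % 64 = v % 64 ^^^ t := by
  rw [show (64 : ℕ) = 2 ^ 6 from rfl, Nat.xor_mod_two_pow, Nat.mod_eq_of_lt (a := t) ht]

/-- Every block is itself a translation of `GF(64)`, and translations commute. -/
theorem pt_xor {x v t : ℕ} (ht : t < 64) : pt x (v ^^^ t) = pt x v ^^^ t := by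
  rw [pt_eq, pt_eq, xor_div_sixtyfour ht, xor_mod_sixtyfour ht, Nat.xor_assoc, Nat.xor_assoc,
    Nat.xor_comm t]

theorem xor_lt_iff {v t : ℕ} (ht : t < 64) : v ^^^ t < 2048 ↔ v < 2048 := by
  have := xor_div_sixtyfour (v := v) ht
  omega

theorem xor_xor_self (a t : ℕ) : a ^^^ t ^^^ t = a := by
  rw [Nat.xor_assoc, Nat.xor_self, Nat.xor_zero]

/-- The translation by `t` of the variable nodes. -/
def shiftBy (t : ℕ) : ℕ ↪ ℕ := ⟨fun v => v ^^^ t, fun _ _ h => Nat.xor_left_injective h⟩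

theorem shiftBy_apply (t v : ℕ) : shiftBy t v = v ^^^ t := rfl

/-- The translate of `A` by `t`. -/
def translate (t : ℕ) (A : Finset ℕ) : Finset ℕ := A.map (shiftBy t)

theorem mem_translate {t v : ℕ} {A : Finset ℕ} : v ∈ translate t A ↔ v ^^^ t ∈ A := by
  rw [translate, Finset.mem_map]
  constructor
  · rintro ⟨a, ha, rfl⟩
    rwa [shiftBy_apply, xor_xor_self]
  · exact fun h => ⟨_, h, by rw [shiftBy_apply, xor_xor_self]⟩

theorem translate_translate (t : ℕ) (A : Finset ℕ) : translate t (translate t A) = A := by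
  ext v
  rw [mem_translate, mem_translate, xor_xor_self]

theorem mult_translate {t : ℕ} (ht : t < 64) (A : Finset ℕ) (x z : ℕ) :
    mult (translate t A) x z = mult A x (z ^^^ t) := by
  rw [mult, translate, Finset.filter_map, Finset.card_map, mult]
  congr 1
  ext v
  simp only [Finset.mem_filter, Function.comp_apply, shiftBy_apply, pt_xor ht]
  refine and_congr_right fun _ => ⟨?_, ?_⟩
  · rintro rfl
    rw [xor_xor_self]
  · intro h
    rw [h, xor_xor_self]

theorem Good.translate {A : Finset ℕ} (hA : Good A) {t : ℕ} (ht : t < 64) :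
    Good (translate t A) := by
  refine ⟨fun v hv => ?_, ?_, fun v hv => ?_, ?_⟩
  · exact (xor_lt_iff ht).1 (hA.1 _ (mem_translate.1 hv))
  · rw [AbsorptionSearch.translate, Finset.card_map, hA.2.1]
  · have := hA.2.2.1 _ (mem_translate.1 hv)
    simpa only [mult_translate ht, pt_xor ht] using this
  · rw [← hA.2.2.2]
    refine Finset.sum_congr rfl fun x _ => ?_
    refine Finset.card_bij' (fun z _ => z ^^^ t) (fun z _ => z ^^^ t) ?_ ?_ ?_ ?_
    · intro z hz
      simp only [Finset.mem_filter, Finset.mem_range, mult_translate ht] at hz ⊢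
      exact ⟨Nat.xor_lt_two_pow (n := 6) hz.1 ht, hz.2⟩
    · intro z hz
      simp only [Finset.mem_filter, Finset.mem_range, mult_translate ht] at hz ⊢
      exact ⟨Nat.xor_lt_two_pow (n := 6) hz.1 ht, by rw [xor_xor_self]; exact hz.2⟩
    · exact fun z _ => xor_xor_self z t
    · exact fun z _ => xor_xor_self z t

/-! ## The test of absorption sets -/

theorem occ_eq {l : List ℕ} (hl : l.Nodup) (v x : ℕ) : occ l v x = mult l.toFinset x (pt x v) := by
  have h : occ l v x = l.countP fun w => pt x w = pt x v := by
    clear hl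
    induction l with
    | nil => rfl
    | cons w l ih =>
      change ite0 (Nat.xor (pt x w) (pt x v)) (occ l v x + 1) (occ l v x) = _
      have e : Nat.xor (pt x w) (pt x v) = 0 ↔ pt x w = pt x v := Nat.xor_eq_zero_iff
      rw [ite0_eq, List.countP_cons, ih]
      simp only [e, decide_eq_true_eq]
      split_ifs <;> rfl
  rw [h, mult, List.countP_eq_length_filter, ← List.toFinset_card_of_nodup (hl.filter _)]
  congr 1
  ext w
  simp

theorem sumRows_eq (f : ℕ → ℕ) : sumRows f = ∑ x ∈ Finset.range 6, f x := by
  simp only [Finset.sum_range_succ, Finset.sum_range_zero]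
  change f 0 + (f 1 + (f 2 + (f 3 + (f 4 + f 5)))) = _
  ring

theorem evens_eq {l : List ℕ} (hl : l.Nodup) (v : ℕ) :
    evens l v = ((Finset.range 6).filter fun x => Even (mult l.toFinset x (pt x v))).card := by
  rw [evens, sumRows_eq, Finset.card_filter]
  refine Finset.sum_congr rfl fun x _ => ?_
  rw [occ_eq hl]
  change 1 - _ % 2 = _
  split_ifs with h
  · rw [Nat.even_iff.1 h]
  · rw [Nat.not_even_iff.1 h]

theorem sum_oddShare {l : List ℕ} (hl : l.Nodup) (hlen : l.length = 8) :
    (l.map (oddShare l)).sum = 105 * ∑ x ∈ Finset.range 6,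
      ((Finset.range 64).filter fun z => Odd (mult l.toFinset x z)).card := by
  rw [← List.sum_toFinset _ hl]
  have h1 (v : ℕ) : oddShare l v = ∑ x ∈ Finset.range 6,
      (fun m => m % 2 * (105 / m)) (mult l.toFinset x (pt x v)) := by
    rw [oddShare, sumRows_eq]
    refine Finset.sum_congr rfl fun x _ => ?_
    rw [occ_eq hl]
    rfl
  rw [Finset.sum_congr rfl fun v _ => h1 v, Finset.sum_comm, Finset.mul_sum]
  refine Finset.sum_congr rfl fun x _ => ?_
  rw [sum_mult l.toFinset x (fun m => m % 2 * (105 / m)), Finset.card_filter, Finset.mul_sum]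
  refine Finset.sum_congr rfl fun z _ => ?_
  have := mult_le_card l.toFinset x z
  rw [List.toFinset_card_of_nodup hl, hlen] at this
  generalize mult l.toFinset x z = m at this
  -- Only `m ≤ 8` occurs, and every odd such `m` divides `105`.
  interval_cases m <;> rfl

theorem isGood_iff {l : List ℕ} (hl : l.Nodup) (hlen : l.length = 8) (hlt : ∀ v ∈ l, v < 2048) :
    isGood l = true ↔ Good l.toFinset := by
  have e : isGood l = (l.all (fun v => Nat.ble 4 (evens l v)) &&
      Nat.beq ((l.map (oddShare l)).sum) 840) := rfl
  rw [e, Bool.and_eq_true, List.all_eq_true, sum_oddShare hl hlen]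
  simp only [Nat.ble_eq, Nat.beq_eq, evens_eq hl]
  refine ⟨fun h => ⟨?_, ?_, ?_, ?_⟩, fun h => ⟨?_, ?_⟩⟩
  · exact fun v hv => hlt v (List.mem_toFinset.1 hv)
  · rw [List.toFinset_card_of_nodup hl, hlen]
  · exact fun v hv => h.1 v (List.mem_toFinset.1 hv)
  · omega
  · exact fun v hv => h.2.2.1 v (List.mem_toFinset.2 hv)
  · rw [h.2.2.2]

/-! ## No check node is connected more than twice -/

theorem share_eq {α : Type} (a : ℕ) (f : ℕ → α) : share a f = f a := by rw [share]

theorem exists_mem_iter {α : Type} {C c : ℕ} {f : ℕ → ℕ → List α} {p : α → Prop} {u : ℕ}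
    (hC : ∀ w, C.testBit w = true → w < 2048) (hu : C.testBit u = true)
    (h : ∀ c', (∀ w, c'.testBit w = true ↔
      c.testBit w = true ∧ ¬(C.testBit w = true ∧ w ≤ u)) → ∃ l ∈ f u c', p l) :
    ∃ l ∈ iter 2048 C c f, p l := by
  obtain ⟨c', hc', hsub⟩ := exists_subset_iter c f hC hu
  obtain ⟨l, hl, hp⟩ := h c' hc'
  exact ⟨l, hsub hl, hp⟩

theorem exists_mem_extend_of_eq {u : ℕ} {B : List ℕ} {ne : ℕ} (hne : pairDefect (u :: B) = ne)
    {D : Finset ℕ} (hD : ∀ v ∈ D, v < 2048) {K : ℕ}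
    (hK : ∑ v ∈ D, defect D v ≤ 2 * K) (h3 : ∀ v ∈ D, defect D v ≤ 3) {S B₀ : List ℕ}
    (hS : ∀ p ∈ S, ∀ u ∈ D, ∀ w ∈ D, u ≠ w → u ≠ p → w ≠ p → Adj p u ∨ Adj p w)
    (hSD : ∀ p ∈ S, p ∈ D) (hSB : S ⊆ B₀) {R : List ℕ → ℕ}
    (hR : ∀ B, B₀ ⊆ B → (∀ v ∈ B, v ∈ D) → ∀ u ∈ D, u ∉ B → ∀ w ∈ D, w ∉ B → w ≠ u →
      ∀ x < 6, ∀ r, (R B).testBit r = true → pt x r = pt x u → pt x w ≠ pt x u)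
    {n c : ℕ} (hB : (u :: B).Nodup) (hBD : ∀ v ∈ u :: B, v ∈ D)
    (hB₀ : B₀ ⊆ B) (hcard : D.card = (u :: B).length + n)
    (hc : ∀ w, c.testBit w = true → w < 2048) (hDc : ∀ w ∈ D, w ∉ u :: B → c.testBit w = true) :
    ∃ l ∈ extend K R S n u B ne c, l.Nodup ∧ l.toFinset = D := by
  subst hne
  exact exists_mem_extend hD hK h3 hS hSD hSB hR n u B c hB hBD hB₀ hcard hc hDc

theorem exists_lt_lt_of_three_le_card {s : Finset ℕ} (h : 3 ≤ s.card) :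
    ∃ a ∈ s, ∃ b ∈ s, ∃ d ∈ s, a < b ∧ b < d :=
  have hlt {i k : Fin s.card} (hik : i < k) := (s.orderEmbOfFin rfl).strictMono hik
  ⟨_, s.orderEmbOfFin_mem rfl ⟨0, by omega⟩, _, s.orderEmbOfFin_mem rfl ⟨1, by omega⟩, _,
    s.orderEmbOfFin_mem rfl ⟨2, by omega⟩, hlt (by simp), hlt (by simp)⟩

theorem miss_eq_zero_iff {w : ℕ} {B : List ℕ} : miss w B = 0 ↔ ∀ b ∈ B, Adj w b := by
  simp [miss, List.countP_eq_zero]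

theorem adj_or_adj_of_defect_le_one {D : Finset ℕ} {p u w : ℕ} (h : defect D p ≤ 1) (hu : u ∈ D)
    (hw : w ∈ D) (huw : u ≠ w) (hup : u ≠ p) (hwp : w ≠ p) : Adj p u ∨ Adj p w := by
  by_contra! hn
  refine huw (Finset.card_le_one.1 h u ?_ w ?_)
  · exact Finset.mem_filter.2 ⟨hu, hup.symm, hn.1⟩
  · exact Finset.mem_filter.2 ⟨hw, hwp.symm, hn.2⟩

theorem three_le_mult {A : Finset ℕ} {r u w y z : ℕ} (hr : r ∈ A) (hu : u ∈ A) (hw : w ∈ A)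
    (hru : r ≠ u) (hrw : r ≠ w) (huw : u ≠ w) (h₁ : pt y r = z) (h₂ : pt y u = z)
    (h₃ : pt y w = z) : 3 ≤ mult A y z :=
  Finset.two_lt_card.2 ⟨r, Finset.mem_filter.2 ⟨hr, h₁⟩, u, Finset.mem_filter.2 ⟨hu, h₂⟩, w,
    Finset.mem_filter.2 ⟨hw, h₃⟩, hru, hrw, huw⟩

namespace Good

variable {A : Finset ℕ} (hA : Good A)
include hA

/-- Count missing pairs between the `m` elements on the check and the `8 - m` others. Were each of
the latter joined to at most two of the former, there would be at least `(8 - m)(m - 2)`; but each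
element on the check misses at most one, so there are at most `m`. This fails for `m = 3` and `m =
4`. -/
theorem exists_three_le_card_adj {x : ℕ} (hx : x < 6) (hm : 3 ≤ mult A x 0) :
    ∃ q ∈ A.filter (fun v => ¬ pt x v = 0),
      3 ≤ ((A.filter fun v => pt x v = 0).filter (Adj q)).card := by
  set P := A.filter fun v => pt x v = 0 with hP
  set Q := A.filter fun v => ¬ pt x v = 0 with hQ
  have hPQ : P.card + Q.card = 8 := by rw [Finset.card_filter_add_card_filter_not, hA.2.1]
  have hm4 : P.card ≤ 4 := hA.mult_le_four hx 0
  have hm3 : 3 ≤ P.card := hm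
  by_contra! hn
  have h1 : ∑ q ∈ Q, (P.card - 2) ≤ ∑ q ∈ Q, defect P q := by
    refine Finset.sum_le_sum fun q hq => ?_
    have e : defect P q = (P.filter fun w => ¬ Adj q w).card := by
      rw [defect]
      congr 1
      refine Finset.filter_congr fun w hw => and_iff_right ?_
      rintro rfl
      exact (Finset.mem_filter.1 hq).2 (Finset.mem_filter.1 hw).2
    have := hn q hq
    have := Finset.card_filter_add_card_filter_not (s := P) (Adj q)
    omega
  have h2 : ∑ q ∈ P, defect Q q ≤ ∑ q ∈ P, 1 := by
    refine Finset.sum_le_sum fun q hq => ?_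
    obtain ⟨hqA, hq0⟩ := Finset.mem_filter.1 hq
    exact (defect_mono (Finset.filter_subset _ _) q).trans
      (hA.defect_le_one hqA hx (by rwa [hq0]))
  rw [sum_defect_comm Q P] at h1
  rw [Finset.sum_const, smul_eq_mul] at h1 h2
  generalize P.card = m at *
  interval_cases m <;> omega

/-- The set found consists of all elements off the check and three on it, `a < b < d`, joined to
`q`. If the check is connected four times, one element is left out. -/
theorem exists_mem_bundles {x : ℕ} (hx : x < 6) (hm : 3 ≤ mult A x 0) {K n : ℕ}
    (hK : ∑ v ∈ A, defect A v ≤ 2 * K) (hn : mult A x 0 + (n + 1) = 8) :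
    ∃ l ∈ bundles K n x, l.Nodup ∧ l.length = n + 4 ∧ (∀ v ∈ l, v ∈ A) ∧
      ∀ v ∈ A, pt x v ≠ 0 → v ∈ l := by
  set P := A.filter fun v => pt x v = 0 with hP
  set Q := A.filter fun v => ¬ pt x v = 0 with hQ
  have hPQ : P.card + Q.card = 8 := by rw [Finset.card_filter_add_card_filter_not, hA.2.1]
  have hm' : mult A x 0 = P.card := rfl
  set T := Q.filter fun q => 3 ≤ (P.filter (Adj q)).card with hT
  have hTne : T.Nonempty := by
    obtain ⟨q, hq, h⟩ := hA.exists_three_le_card_adj hx hm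
    exact ⟨q, Finset.mem_filter.2 ⟨hq, h⟩⟩
  obtain ⟨q, hqT, hqmin⟩ : ∃ q ∈ T, ∀ w ∈ T, q ≤ w :=
    ⟨T.min' hTne, T.min'_mem hTne, fun w hw => T.min'_le w hw⟩
  obtain ⟨hqQ, hq3⟩ := Finset.mem_filter.1 hqT
  obtain ⟨hqA, hqx⟩ := Finset.mem_filter.1 hqQ
  obtain ⟨a, ha, b, hb, d, hd, hab, hbd⟩ := exists_lt_lt_of_three_le_card hq3
  obtain ⟨haP, haq⟩ := Finset.mem_filter.1 ha
  obtain ⟨hbP, hbq⟩ := Finset.mem_filter.1 hb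
  obtain ⟨hdP, hdq⟩ := Finset.mem_filter.1 hd
  obtain ⟨haA, hax⟩ := Finset.mem_filter.1 haP
  obtain ⟨hbA, hbx⟩ := Finset.mem_filter.1 hbP
  obtain ⟨hdA, hdx⟩ := Finset.mem_filter.1 hdP
  set D := [d, b, a].toFinset ∪ Q with hD
  have hmemP {r : ℕ} (hr : r ∈ [d, b, a]) : r ∈ P := by
    simp only [List.mem_cons, List.not_mem_nil, or_false] at hr
    rcases hr with rfl | rfl | rfl <;> assumption
  have hDA : D ⊆ A := by
    refine Finset.union_subset (fun r hr => ?_) (Finset.filter_subset _ _)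
    exact (Finset.mem_filter.1 (hmemP (List.mem_toFinset.1 hr))).1
  have hDQ {w : ℕ} (hw : w ∈ D) (hwB : w ∉ [d, b, a]) : w ∈ Q := by
    rcases Finset.mem_union.1 hw with h | h
    · exact absurd (List.mem_toFinset.1 h) hwB
    · exact h
  have hnd : [d, b, a].Nodup := by
    simp only [List.nodup_cons, List.mem_cons, List.not_mem_nil, or_false, not_false_eq_true,
      List.nodup_nil, and_true]
    omega
  have hDcard : D.card = n + 4 := by
    rw [hD, Finset.card_union_of_disjoint, List.toFinset_card_of_nodup hnd]
    · simp only [List.length_cons, List.length_nil]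
      omega
    · refine Finset.disjoint_left.2 fun r hr hrQ => ?_
      exact (Finset.mem_filter.1 hrQ).2 (Finset.mem_filter.1 (hmemP (List.mem_toFinset.1 hr))).2
  have hclique {r s : ℕ} (hr : r ∈ P) (hs : s ∈ P) (hrs : r ≠ s) : Adj r s :=
    ⟨hrs, x, hx, (Finset.mem_filter.1 hr).2.trans (Finset.mem_filter.1 hs).2.symm⟩
  have hpair : pairDefect [q, d, b, a] = 0 := by
    have h1 : miss q [d, b, a] = 0 := by
      rw [miss_eq_zero_iff]
      simp [haq, hbq, hdq]
    have h2 : miss d [b, a] = 0 := by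
      rw [miss_eq_zero_iff]
      simp [hclique hdP hbP hbd.ne', hclique hdP haP (hab.trans hbd).ne']
    have h3 : miss b [a] = 0 := by
      rw [miss_eq_zero_iff]
      simp [hclique hbP haP hab.ne']
    simp only [pairDefect, h1, h2, h3]
    rfl
  suffices H : ∃ l ∈ bundles K n x, l.Nodup ∧ l.toFinset = D by
    obtain ⟨l, hl, hln, hlD⟩ := H
    refine ⟨l, hl, hln, ?_, fun v hv => ?_, fun v hv hvx => ?_⟩
    · rw [← List.toFinset_card_of_nodup hln, hlD, hDcard]
    · exact hDA (hlD ▸ List.mem_toFinset.2 hv)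
    · rw [← List.mem_toFinset, hlD]
      exact Finset.mem_union_right _ (Finset.mem_filter.2 ⟨hv, hvx⟩)
  have hL (w : ℕ) := testBit_line x w (z := 0) (by norm_num)
  have hc₀ (w : ℕ) : (sdiffN ones (line x 0)).testBit w = true ↔ w < 2048 ∧ pt x w ≠ 0 := by
    rw [testBit_sdiffN, testBit_ones, Bool.and_eq_true, Bool.not_eq_true', ← Bool.not_eq_true, hL,
      decide_eq_true_eq]
    tauto
  have hM (w : ℕ) : (Nat.land (nbr q) (line x 0)).testBit w = true ↔
      w < 2048 ∧ Adj q w ∧ pt x w = 0 := by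
    rw [testBit_land, Bool.and_eq_true, hL, testBit_nbr]
    tauto
  rw [bundles]
  simp only [share_eq]
  refine exists_mem_iter (u := q) (fun w hw => ((hc₀ w).1 hw).1) ((hc₀ q).2 ⟨hA.1 q hqA, hqx⟩)
    fun c' hc' => ?_
  refine exists_mem_iter (u := a) (fun w hw => ((hM w).1 hw).1) ((hM a).2 ⟨hA.1 a haA, haq, hax⟩)
    fun Ma hMa => ?_
  refine exists_mem_iter (u := b) (fun w hw => ((hM w).1 ((hMa w).1 hw).1).1)
    ((hMa b).2 ⟨(hM b).2 ⟨hA.1 b hbA, hbq, hbx⟩, fun h => hab.not_ge h.2⟩) fun Mb hMb => ?_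
  refine exists_mem_iter (u := d) (fun w hw => ((hM w).1 ((hMa w).1 ((hMb w).1 hw).1).1).1)
    ((hMb d).2 ⟨(hMa d).2 ⟨(hM d).2 ⟨hA.1 d hdA, hdq, hdx⟩,
      fun h => (hab.trans hbd).not_ge h.2⟩, fun h => hbd.not_ge h.2⟩) fun _ _ => ?_
  have hdefect {p : ℕ} (hp : p ∈ P) : defect A p ≤ 1 := by
    obtain ⟨hpA, hpx⟩ := Finset.mem_filter.1 hp
    exact hA.defect_le_one hpA hx (by rwa [hpx])
  have hqB : q ∉ [d, b, a] := fun h => hqx (Finset.mem_filter.1 (hmemP h)).2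
  have hqD : q ∈ D := Finset.mem_union_right _ hqQ
  have hBD : ∀ v ∈ [d, b, a], v ∈ D := fun v hv =>
    Finset.mem_union_left _ (List.mem_toFinset.2 hv)
  refine exists_mem_extend_of_eq hpair (B₀ := [d, b, a]) (fun v hv => hA.1 v (hDA hv)) ?_
    (fun v hv => (defect_mono hDA v).trans (hA.defect_le_three (hDA hv))) ?_ hBD
    (List.Subset.refl _) ?_ (List.nodup_cons.2 ⟨hqB, hnd⟩)
    (List.forall_mem_cons.2 ⟨hqD, hBD⟩) (List.Subset.refl _) ?_ ?_ ?_
  · refine le_trans ?_ hK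
    exact (Finset.sum_le_sum fun v _ => defect_mono hDA v).trans
      (Finset.sum_le_sum_of_subset hDA)
  · intro p hp u hu w hw huw hup hwp
    exact adj_or_adj_of_defect_le_one (hdefect (hmemP hp)) (hDA hu) (hDA hw) huw hup hwp
  · intro B hB _ u hu huB w hw hwB hwu y hy r hr hru hwu'
    rw [testBit_bits, decide_eq_true_eq] at hr
    have huQ := hDQ hu fun h => huB (hB h)
    have hwQ := hDQ hw fun h => hwB (hB h)
    obtain ⟨hrA, hrx⟩ := Finset.mem_filter.1 (hmemP hr)
    -- A check through `r`, `u` and `w` is connected three times, so it is the given one, the only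
    -- such check at `r`; but `u` lies off it.
    have h1 : 3 ≤ mult A y (pt y r) := three_le_mult hrA (hDA hu) (hDA hw)
      (fun h => huB (hB (h ▸ hr))) (fun h => hwB (hB (h ▸ hr))) hwu.symm rfl hru.symm
      (hwu'.trans hru.symm)
    have h2 := hA.eq_of_three_le_mult hrA hx hy (by rwa [hrx]) h1
    subst h2
    exact (Finset.mem_filter.1 huQ).2 (hru.symm.trans hrx)
  · rw [hDcard]
    simp only [List.length_cons, List.length_nil]
    omega
  · intro w hw
    rw [testBit_sdiffN, Bool.and_eq_true] at hw
    exact ((hc₀ w).1 hw.1).1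
  · intro w hw hwB
    have hwQ := hDQ hw fun h => hwB (List.mem_cons_of_mem _ h)
    obtain ⟨hwA, hwx⟩ := Finset.mem_filter.1 hwQ
    have hwc := (hc₀ w).2 ⟨hA.1 w hwA, hwx⟩
    have hqw : q ≠ w := fun h => hwB (h ▸ List.mem_cons_self)
    rw [testBit_sdiffN, testBit_lor, testBit_single, testBit_land, testBit_xor, hwc,
      Bool.true_and, Bool.not_eq_true', Bool.or_eq_false_iff, decide_eq_false_iff_not]
    refine ⟨hqw, ?_⟩
    rw [← Bool.not_eq_true, Bool.and_eq_true, testBit_near, Nat.le_zero, miss_eq_zero_iff]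
    rintro ⟨h1, -, h2⟩
    have h3 : w ≤ q := by
      by_contra h
      rw [(hc' w).2 ⟨hwc, fun h' => h h'.2⟩] at h1
      cases h1
    have h4 : w ∈ T := by
      refine Finset.mem_filter.2 ⟨hwQ, ?_⟩
      rw [← show [d, b, a].toFinset.card = 3 from List.toFinset_card_of_nodup hnd]
      refine Finset.card_le_card fun r hr => ?_
      have hr := List.mem_toFinset.1 hr
      exact Finset.mem_filter.2 ⟨hmemP hr, h2 r hr⟩
    exact hqw (le_antisymm (hqmin w h4) h3)

theorem mult_zero_le_two {x : ℕ} (hx : x < 6) : mult A x 0 ≤ 2 := by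
  by_contra! hm
  have hcheck := isHeavyFree_of_lt hx
  rw [isHeavyFree, Bool.and_eq_true, List.all_eq_true, List.all_eq_true] at hcheck
  have hsum := hA.sum_defect_le hx (z₀ := 0) (by norm_num)
  have hcontra {l : List ℕ} (hln : l.Nodup) (hlen : l.length = 8) (hlA : ∀ v ∈ l, v ∈ A)
      (hl : (!isGood l) = true) : False := by
    have e : l.toFinset = A := by
      refine Finset.eq_of_subset_of_card_le (fun v hv => hlA v (List.mem_toFinset.1 hv)) ?_
      rw [hA.2.1, List.toFinset_card_of_nodup hln, hlen]
    rw [(isGood_iff hln hlen fun v hv => hA.1 v (hlA v hv)).2 (e.symm ▸ hA)] at hl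
    cases hl
  have hm4 := hA.mult_le_four hx 0
  obtain hm | hm : mult A x 0 = 3 ∨ mult A x 0 = 4 := by omega
  · rw [if_pos hm] at hsum
    -- The total defect is at most `16 - 4 = 2 * 6` here and at most `16 - 8 = 2 * 4` in the other
    -- case.
    obtain ⟨l, hl, hln, hlen, hlA, -⟩ := hA.exists_mem_bundles hx (by omega) (K := 6) (n := 4)
      (by omega) (by omega)
    exact hcontra hln hlen hlA (hcheck.1 l hl)
  · rw [if_neg (by omega), if_pos (by omega)] at hsum
    obtain ⟨l, hl, hln, hlen, hlA, hAl⟩ := hA.exists_mem_bundles hx (by omega) (K := 4) (n := 3)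
      (by omega) (by omega)
    obtain ⟨p, hp, hpl⟩ : ∃ p ∈ A, p ∉ l := by
      by_contra! h
      have := Finset.card_le_card fun v hv => List.mem_toFinset.2 (h v hv)
      rw [hA.2.1, List.toFinset_card_of_nodup hln] at this
      omega
    have hpx : pt x p = 0 := by
      by_contra h
      exact hpl (hAl p hp h)
    have hC : (sdiffN (Nat.land (line x 0) (near l 1)) (bits l)).testBit p = true := by
      rw [testBit_sdiffN, testBit_land, Bool.and_eq_true, Bool.and_eq_true, testBit_bits,
        testBit_line x p (by norm_num), testBit_near, Bool.not_eq_true', decide_eq_false_iff_not]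
      refine ⟨⟨⟨hA.1 p hp, hpx⟩, hA.1 p hp, ?_⟩, hpl⟩
      rw [← defect_toFinset hln hpl]
      exact (defect_mono (fun v hv => hlA v (List.mem_toFinset.1 hv)) p).trans
        (hA.defect_le_one hp hx (by rw [hpx]; omega))
    have h := hcheck.2 l hl
    rw [share_eq, List.all_eq_true] at h
    obtain ⟨l', hl', rfl⟩ := exists_mem_iter (f := fun p _ => [p :: l]) (p := (· = p :: l))
      (c := sdiffN (Nat.land (line x 0) (near l 1)) (bits l)) (fun w hw => by
        rw [testBit_sdiffN, testBit_land, Bool.and_eq_true, Bool.and_eq_true, testBit_near] at hw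
        exact hw.1.2.1) hC fun _ _ => ⟨_, List.mem_singleton.2 rfl, rfl⟩
    exact hcontra (List.nodup_cons.2 ⟨hpl, hln⟩) (by simp [hlen])
      (List.forall_mem_cons.2 ⟨hp, hlA⟩) (h _ hl')

/-- Translation by `z` moves the check to index `0`. -/
theorem mult_le_two {x z : ℕ} (hx : x < 6) (hz : z < 64) : mult A x z ≤ 2 := by
  have := (hA.translate hz).mult_zero_le_two hx
  rwa [mult_translate hz, Nat.zero_xor] at this

end Good

/-! ## All absorption sets are found -/

theorem testBit_ones_sub (v w : ℕ) (hv : v < 2048) :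
    (Nat.sub ones (Nat.sub (single (Nat.succ v)) 1)).testBit w = true ↔ w < 2048 ∧ v < w := by
  -- Subtracting `x + 1` from `2 ^ 2048` complements the digits of `x`; here `x` marks the nodes up
  -- to `v`.
  have e : Nat.sub ones (Nat.sub (single (Nat.succ v)) 1) = 2 ^ 2048 - (2 ^ (v + 1) - 1 + 1) := by
    change single 2048 - 1 - (single (v + 1) - 1) = _
    rw [single_eq, single_eq, Nat.sub_sub, add_comm]
  have hlt : 2 ^ (v + 1) - 1 < 2 ^ 2048 :=
    lt_of_lt_of_le (Nat.sub_lt (Nat.two_pow_pos _) one_pos)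
      (Nat.pow_le_pow_right two_pos hv)
  rw [e, Nat.testBit_two_pow_sub_succ hlt, Nat.testBit_two_pow_sub_one]
  simp only [Bool.and_eq_true, decide_eq_true_eq, Bool.not_eq_true', decide_eq_false_iff_not]
  omega

namespace Good

variable {A : Finset ℕ} (hA : Good A)
include hA

theorem sum_defect_le_sixteen : ∑ v ∈ A, defect A v ≤ 16 :=
  (Nat.le_add_right _ _).trans (hA.sum_defect_le (x₀ := 0) (z₀ := 0) (by norm_num) (by norm_num))

theorem pt_ne_of_pt_eq {r u w x : ℕ} (hr : r ∈ A) (hu : u ∈ A) (hw : w ∈ A) (hru : r ≠ u)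
    (hrw : r ≠ w) (huw : u ≠ w) (hx : x < 6) (h : pt x r = pt x u) : pt x w ≠ pt x u := fun h' =>
  (three_le_mult hr hu hw hru hrw huw h rfl h').not_gt
    (Nat.lt_succ_of_le (hA.mult_le_two hx (pt_lt x u)))

/-- Otherwise the `N` neighbors of `v₀` are pairwise not joined. With the `7 - N` pairs that `v₀`
misses, counted from both ends, the total defect is at least `N (N - 1) + 2 (7 - N)`, which exceeds
`16` because `N ≥ 4`. -/
theorem exists_triangle {v₀ : ℕ} (hv₀ : v₀ ∈ A) :
    ∃ v ∈ A, ∃ w ∈ A, Adj v₀ v ∧ Adj v₀ w ∧ Adj v w := by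
  by_contra! hn
  set N := A.filter (Adj v₀) with hN
  have hdeg : N.card + defect A v₀ + 1 = 8 := by
    rw [← hA.2.1]
    exact degree_add_defect hv₀
  have h3 := hA.defect_le_three hv₀
  have h1 {v : ℕ} (hv : v ∈ N) : N.card - 1 ≤ defect A v := by
    rw [← Finset.card_erase_of_mem hv]
    refine Finset.card_le_card fun w hw => ?_
    obtain ⟨hwv, hwN⟩ := Finset.mem_erase.1 hw
    obtain ⟨hvA, hv'⟩ := Finset.mem_filter.1 hv
    obtain ⟨hwA, hw'⟩ := Finset.mem_filter.1 hwN
    exact Finset.mem_filter.2 ⟨hwA, hwv.symm, hn v hvA w hwA hv' hw'⟩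
  have h2 {v : ℕ} (hv : v ∈ (A.filter fun v => ¬ Adj v₀ v).erase v₀) : 1 ≤ defect A v := by
    obtain ⟨hvv, hv⟩ := Finset.mem_erase.1 hv
    obtain ⟨hvA, hv'⟩ := Finset.mem_filter.1 hv
    exact Finset.card_pos.2 ⟨v₀, Finset.mem_filter.2 ⟨hv₀, hvv, fun h => hv' h.symm⟩⟩
  have hv₀' : v₀ ∈ A.filter fun v => ¬ Adj v₀ v := Finset.mem_filter.2 ⟨hv₀, fun h => h.1 rfl⟩
  have h4 := hA.sum_defect_le_sixteen
  have hcard := Finset.card_filter_add_card_filter_not (s := A) (Adj v₀)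
  have hcard' := Finset.card_erase_add_one hv₀'
  rw [hA.2.1, ← hN] at hcard
  rw [← Finset.sum_filter_add_sum_filter_not A (Adj v₀), ← hN, ← Finset.add_sum_erase _ _ hv₀'] at h4
  have h5 := Finset.card_nsmul_le_sum _ _ _ fun v hv => h1 hv
  have h6 := Finset.card_nsmul_le_sum _ _ _ fun v hv => h2 hv
  rw [smul_eq_mul] at h5 h6
  have h7 : 4 * 3 ≤ N.card * (N.card - 1) := Nat.mul_le_mul (by omega) (by omega)
  have : N.card = 4 := by
    by_contra h
    have h8 : 5 * 4 ≤ N.card * (N.card - 1) := Nat.mul_le_mul (by omega) (by omega)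
    omega
  omega

/-- The branch to follow takes for `v₁` the least element in a triangle with `v₀`, and for `v₂` the
least element joined to both. These minimal choices justify the discarded candidates. -/
theorem exists_mem_leaves {j : ℕ} (h₀ : 64 * j ∈ A) (hmin : ∀ v ∈ A, 64 * j ≤ v) :
    ∃ l ∈ leaves j, l.Nodup ∧ l.toFinset = A := by
  rw [leaves, force_eq]
  simp only [share_eq]
  change 64 * j ∈ A at h₀
  generalize hv₀ : Nat.mul 64 j = v₀
  replace hmin : ∀ v ∈ A, v₀ ≤ v := hv₀ ▸ hmin
  replace h₀ : v₀ ∈ A := hv₀ ▸ h₀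
  have hlt := hA.1 v₀ h₀
  have hc₀ (w : ℕ) := testBit_ones_sub v₀ w hlt
  have hc₀A {w : ℕ} (hw : w ∈ A) (h : w ≠ v₀) :
      (Nat.sub ones (Nat.sub (single (Nat.succ v₀)) 1)).testBit w = true :=
    (hc₀ w).2 ⟨hA.1 w hw, lt_of_le_of_ne (hmin w hw) h.symm⟩
  generalize Nat.sub ones (Nat.sub (single (Nat.succ v₀)) 1) = c₀ at hc₀ hc₀A ⊢
  set T₁ := A.filter fun v => Adj v₀ v ∧ ∃ w ∈ A, Adj v₀ w ∧ Adj v w with hT₁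
  have hT₁ne : T₁.Nonempty := by
    obtain ⟨v, hv, w, hw, h⟩ := hA.exists_triangle h₀
    exact ⟨v, Finset.mem_filter.2 ⟨hv, h.1, w, hw, h.2⟩⟩
  obtain ⟨v₁, hv₁, hmin₁⟩ : ∃ v ∈ T₁, ∀ w ∈ T₁, v ≤ w :=
    ⟨T₁.min' hT₁ne, T₁.min'_mem hT₁ne, fun w hw => T₁.min'_le w hw⟩
  obtain ⟨h₁, h₀₁, htri⟩ := Finset.mem_filter.1 hv₁
  set T₂ := A.filter fun v => Adj v₀ v ∧ Adj v₁ v with hT₂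
  have hT₂ne : T₂.Nonempty := by
    obtain ⟨w, hw, h⟩ := htri
    exact ⟨w, Finset.mem_filter.2 ⟨hw, h⟩⟩
  obtain ⟨v₂, hv₂, hmin₂⟩ : ∃ v ∈ T₂, ∀ w ∈ T₂, v ≤ w :=
    ⟨T₂.min' hT₂ne, T₂.min'_mem hT₂ne, fun w hw => T₂.min'_le w hw⟩
  obtain ⟨h₂, h₀₂, h₁₂⟩ := Finset.mem_filter.1 hv₂
  have hC₁ (w : ℕ) : (Nat.land (nbr v₀) c₀).testBit w = true ↔
      Adj v₀ w ∧ c₀.testBit w = true := by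
    rw [testBit_land, Bool.and_eq_true, testBit_nbr, hc₀]
    tauto
  refine exists_mem_iter (u := v₁) (fun w hw => ((hc₀ w).1 ((hC₁ w).1 hw).2).1)
    ((hC₁ v₁).2 ⟨h₀₁, hc₀A h₁ h₀₁.1.symm⟩) fun c' hc' => ?_
  have hE (w : ℕ) (hw : (Nat.xor c₀ c').testBit w = true) (hw₀ : c₀.testBit w = true) :
      Adj v₀ w ∧ w ≤ v₁ := by
    rw [testBit_xor, hw₀, Bool.true_xor, Bool.not_eq_true', ← Bool.not_eq_true, hc', hC₁] at hw
    tauto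
  set c₁ := prune v₁ (single v₀)
    (sdiffN c₀ (Nat.lor (Nat.land (Nat.xor c₀ c') (nbr v₁)) (single v₁))) with hc₁def
  have hc₁ (w : ℕ) (hw : c₁.testBit w = true) : w < 2048 := by
    have := testBit_of_prune hw
    rw [testBit_sdiffN, Bool.and_eq_true, hc₀] at this
    exact this.1.1
  have hc₁A {w : ℕ} (hw : w ∈ A) (hw₀ : w ≠ v₀) (hw₁ : w ≠ v₁) : c₁.testBit w = true := by
    refine testBit_prune ?_ fun x hx r hr hru => ?_
    · rw [testBit_sdiffN, testBit_lor, testBit_land, testBit_single, hc₀A hw hw₀, Bool.true_and,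
        Bool.not_eq_true', Bool.or_eq_false_iff, decide_eq_false_iff_not]
      refine ⟨?_, hw₁.symm⟩
      rw [← Bool.not_eq_true, Bool.and_eq_true, testBit_nbr]
      rintro ⟨h, -, h'⟩
      obtain ⟨h3, h4⟩ := hE w h (hc₀A hw hw₀)
      exact hw₁ (le_antisymm h4 (hmin₁ w (Finset.mem_filter.2 ⟨hw, h3, v₁, h₁, h₀₁, h'.symm⟩)))
    · rw [testBit_single, decide_eq_true_eq] at hr
      subst hr
      exact hA.pt_ne_of_pt_eq h₀ h₁ hw h₀₁.1 hw₀.symm hw₁.symm hx hru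
  have hC₂ (w : ℕ) : (Nat.land (near [v₁, v₀] 0) c₁).testBit w = true ↔
      (Adj v₀ w ∧ Adj v₁ w) ∧ c₁.testBit w = true := by
    rw [testBit_land, Bool.and_eq_true, testBit_near, Nat.le_zero, miss_eq_zero_iff]
    simp only [List.forall_mem_cons, adj_comm (u := w), List.not_mem_nil, false_imp_iff,
      implies_true, and_true]
    exact ⟨fun h => ⟨⟨h.1.2.2, h.1.2.1⟩, h.2⟩, fun h => ⟨⟨hc₁ w h.2, h.1.2, h.1.1⟩, h.2⟩⟩
  refine exists_mem_iter (u := v₂) (fun w hw => hc₁ w ((hC₂ w).1 hw).2)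
    ((hC₂ v₂).2 ⟨⟨h₀₂, h₁₂⟩, hc₁A h₂ h₀₂.1.symm h₁₂.1.symm⟩) fun c'' hc'' => ?_
  have hpair : pairDefect [v₂, v₁, v₀] = 0 := by
    have h1 : miss v₂ [v₁, v₀] = 0 := by
      rw [miss_eq_zero_iff]
      simp [h₁₂.symm, h₀₂.symm]
    have h2 : miss v₁ [v₀] = 0 := by
      rw [miss_eq_zero_iff]
      simp [h₀₁.symm]
    simp only [pairDefect, h1, h2]
    rfl
  refine exists_mem_extend_of_eq hpair (B₀ := []) hA.1 hA.sum_defect_le_sixteen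
    (fun v => hA.defect_le_three) (by simp) (by simp) (List.Subset.refl _) ?_ ?_ ?_
    (List.nil_subset _) ?_ ?_ ?_
  · intro B _ hB u hu huB w hw hwB hwu x hx r hr hru
    rw [testBit_bits, decide_eq_true_eq] at hr
    exact hA.pt_ne_of_pt_eq (hB r hr) hu hw (fun h => huB (h ▸ hr)) (fun h => hwB (h ▸ hr)) hwu.symm
      hx hru
  · simp [h₀₁.1.symm, h₀₂.1.symm, h₁₂.1.symm]
  · simp [h₀, h₁, h₂]
  · rw [hA.2.1]
    rfl
  · intro w hw
    rw [testBit_sdiffN, Bool.and_eq_true, hc''] at hw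
    exact hc₁ w hw.1.1
  · intro w hw hwB
    simp only [List.mem_cons, List.not_mem_nil, or_false, not_or] at hwB
    obtain ⟨hw₂, hw₁, hw₀⟩ := hwB
    rw [testBit_sdiffN, Bool.and_eq_true, Bool.not_eq_true', ← Bool.not_eq_true, hc'', hC₂, testBit_land,
      Bool.and_eq_true, testBit_nbr]
    refine ⟨⟨hc₁A hw hw₀ hw₁, fun h => ?_⟩, fun h => ?_⟩
    · exact hw₂ (le_antisymm h.2 (hmin₂ w (Finset.mem_filter.2 ⟨hw, h.1.1⟩)))
    · obtain ⟨h3, h4⟩ := hE w h.1 (hc₀A hw hw₀)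
      exact hw₁ (le_antisymm h4
        (hmin₁ w (Finset.mem_filter.2 ⟨hw, h3, v₂, h₂, h₀₂, h.2.2.symm⟩)))

end Good

/-! ## The properties of the sets that are found -/

theorem bits_eq_bits_iff {l m : List ℕ} : bits l = bits m ↔ l.toFinset = m.toFinset := by
  rw [Nat.eq_iff_testBit_eq, Finset.ext_iff]
  simp only [testBit_bits, List.mem_toFinset, decide_eq_decide]

theorem adjB_iff {u w : ℕ} (hw : w < 2048) : adjB u w = true ↔ Adj u w := by
  rw [adjB, Bool.not_eq_true', ← Bool.not_eq_true, Nat.beq_eq, land_eq_zero_iff]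
  simp only [testBit_single, decide_eq_false_iff_not]
  constructor
  · intro h
    push Not at h
    obtain ⟨v, hv, rfl⟩ := h
    exact ((testBit_nbr u w).1 hv).2
  · exact fun h h' => h' w ((testBit_nbr u w).2 ⟨hw, h⟩) rfl

/-- The elements of `A` can be identified with the vertices of `topology88`. -/
def Arrangeable (A : Finset ℕ) : Prop :=
  ∃ o : Fin 8 → ℕ, o.Injective ∧ (∀ v, v ∈ A ↔ ∃ i, o i = v) ∧
    ∀ i k, i ≠ k → (Adj (o i) (o k) ↔ topology88.Adj i k)

theorem testBit_topologyTable (i k : Fin 8) :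
    Nat.testBit topologyTable (8 * i + k) = true ↔ topology88.Adj i k := by
  simp only [topology88, SimpleGraph.fromEdgeSet_adj, Set.mem_insert_iff, Set.mem_singleton_iff]
  revert i k
  decide

/-- The number of elements of `A` in block column `j`. -/
def columnCard (j : ℕ) (A : Finset ℕ) : ℕ := (A.filter fun v => v / 64 = j).card

theorem inColumn_eq {l : List ℕ} (hl : l.Nodup) (j : ℕ) :
    inColumn j l = columnCard j l.toFinset := by
  have h : inColumn j l = l.countP fun w => w / 64 = j := by
    clear hl
    induction l with
    | nil => rfl
    | cons w l ih =>
      change ite0 (Nat.xor (Nat.shiftRight w 6) j) (Nat.succ (inColumn j l)) (inColumn j l) = _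
      rw [ite0_eq, List.countP_cons, ih]
      have e : Nat.xor (Nat.shiftRight w 6) j = 0 ↔ w / 64 = j := by
        change w >>> 6 ^^^ j = 0 ↔ _
        rw [Nat.xor_eq_zero_iff, Nat.shiftRight_eq_div_pow]
      simp only [e, decide_eq_true_eq]
      split_ifs <;> rfl
  rw [h, columnCard, List.countP_eq_length_filter, ← List.toFinset_card_of_nodup (hl.filter _)]
  congr 1
  ext w
  simp

/-- The properties of a candidate `l` whose least element is `64 * j`. -/
structure Rooted (j : ℕ) (l : List ℕ) : Prop where
  nodup : l.Nodup
  good : Good l.toFinset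
  arrangeable : Arrangeable l.toFinset
  mem : 64 * j ∈ l
  le : ∀ v ∈ l, 64 * j ≤ v
  columnCard_le : columnCard j l.toFinset ≤ 2

theorem isArranged_spec {o : List ℕ} (h : isArranged o = true) (hlt : ∀ v ∈ o, v < 2048)
    (hlen : o.length = 8) (i k : Fin 8) (hik : i ≠ k) :
    o.getD i 0 ≠ o.getD k 0 ∧ (Adj (o.getD i 0) (o.getD k 0) ↔ topology88.Adj i k) := by
  simp only [isArranged, List.all_eq_true, List.mem_range] at h
  have h' := h i i.2 k k.2
  rw [Bool.or_eq_true, Nat.beq_eq, Bool.and_eq_true, Bool.not_eq_true', ← Bool.not_eq_true,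
    Nat.beq_eq, beq_iff_eq] at h'
  have h' := h'.resolve_left fun h => hik (Fin.ext h)
  refine ⟨h'.1, ?_⟩
  rw [← testBit_topologyTable, ← h'.2, adjB_iff]
  rw [List.getD_eq_getElem _ _ (by omega)]
  exact hlt _ (List.getElem_mem _)

theorem Rooted.of_isRooted {j : ℕ} {l : List ℕ} (h : isRooted j l = true) : Rooted j l := by
  simp only [isRooted, Bool.and_eq_true, Nat.beq_eq, List.all_eq_true, List.any_eq_true,
    Nat.ble_eq] at h
  obtain ⟨⟨⟨⟨⟨⟨hlen, hgood⟩, hbits⟩, harr⟩, hle⟩, hmem⟩, hcol⟩ := h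
  have hlt (v : ℕ) (hv : v ∈ l) : v < 2048 := Nat.lt_succ_of_le (hle v hv).2
  have hset := bits_eq_bits_iff.1 hbits
  have hlen' : (arrange l).length = 8 := rfl
  have hspec := isArranged_spec harr (fun v hv => hlt v
    (List.mem_toFinset.1 (hset ▸ List.mem_toFinset.2 hv))) hlen'
  have hinj : Function.Injective fun i : Fin 8 => (arrange l).getD i 0 := by
    intro i k hik
    by_contra hne
    exact (hspec i k hne).1 hik
  have hmem' (v : ℕ) : v ∈ l.toFinset ↔ ∃ i : Fin 8, (arrange l).getD i 0 = v := by
    rw [← hset, List.mem_toFinset, List.mem_iff_getElem]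
    constructor
    · rintro ⟨i, hi, rfl⟩
      exact ⟨⟨i, hi⟩, List.getD_eq_getElem _ _ hi⟩
    · rintro ⟨i, rfl⟩
      exact ⟨i, i.2, (List.getD_eq_getElem _ _ i.2).symm⟩
  -- The arrangement has eight distinct entries and the same set as `l`, so the eight entries of `l`
  -- are distinct too.
  have hcard : l.toFinset.card = l.length := by
    rw [hlen, ← Fintype.card_fin 8, ← Finset.card_univ, ← Finset.card_image_of_injective _ hinj]
    congr 1
    ext v
    rw [hmem', Finset.mem_image]
    simp
  have hnd : l.Nodup := by
    rw [← Multiset.coe_nodup, ← Multiset.toFinset_card_eq_card_iff_nodup]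
    exact hcard
  refine ⟨hnd, (isGood_iff hnd hlen hlt).1 hgood, ⟨_, hinj, hmem', fun i k hik => (hspec i k hik).2⟩,
    ?_, fun v hv => (hle v hv).1, ?_⟩
  · obtain ⟨v, hv, e⟩ := hmem
    rwa [show 64 * j = v from e]
  · rw [← inColumn_eq hnd]
    exact hcol

theorem rooted_of_mem_leaves {j : ℕ} (hj : j < 32) {l : List ℕ} (hl : l ∈ leaves j) :
    Rooted j l := by
  have h := isRootChecked_of_lt hj
  rw [isRootChecked, Bool.and_eq_true, List.all_eq_true] at h
  exact .of_isRooted (h.1 l hl)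

theorem rootCount_eq {j : ℕ} (hj : j < 32) : rootCount j = rootCounts.getD j 0 := by
  have h := isRootChecked_of_lt hj
  rw [isRootChecked, Bool.and_eq_true] at h
  exact Nat.eq_of_beq_eq_true h.2

/-! ### Normalizing sets by translation in their least block column -/

/-- The least block column that meets `A`. -/
noncomputable def column (A : Finset ℕ) : ℕ := sInf {j | ∃ v ∈ A, v / 64 = j}

theorem column_le {A : Finset ℕ} {v : ℕ} (hv : v ∈ A) : column A ≤ v / 64 :=
  Nat.sInf_le ⟨v, hv, rfl⟩

theorem column_translate {t : ℕ} (ht : t < 64) (A : Finset ℕ) :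
    column (translate t A) = column A := by
  rw [column, column]
  congr 1
  ext j
  constructor
  · rintro ⟨v, hv, rfl⟩
    exact ⟨_, mem_translate.1 hv, xor_div_sixtyfour ht⟩
  · rintro ⟨v, hv, rfl⟩
    exact ⟨v ^^^ t, mem_translate.2 (by rwa [xor_xor_self]), xor_div_sixtyfour ht⟩

theorem columnCard_translate {t : ℕ} (ht : t < 64) (j : ℕ) (A : Finset ℕ) :
    columnCard j (translate t A) = columnCard j A := by
  rw [columnCard, translate, Finset.filter_map, Finset.card_map, columnCard]
  congr 1
  refine Finset.filter_congr fun v _ => ?_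
  rw [Function.comp_apply, shiftBy_apply, xor_div_sixtyfour ht]

theorem mul_add_xor {j y t : ℕ} (hy : y < 64) (ht : t < 64) :
    (64 * j + y) ^^^ t = 64 * j + (y ^^^ t) := by
  have h1 := xor_div_sixtyfour (v := 64 * j + y) ht
  have h2 := xor_mod_sixtyfour (v := 64 * j + y) ht
  have e : (64 * j + y) % 64 = y := by omega
  rw [e] at h2
  omega

theorem Arrangeable.of_translate {A : Finset ℕ} {t : ℕ} (ht : t < 64)
    (h : Arrangeable (translate t A)) : Arrangeable A := by
  obtain ⟨o, hinj, hmem, hadj⟩ := h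
  refine ⟨fun i => o i ^^^ t, fun i k h => hinj (Nat.xor_left_injective h), fun v => ?_,
    fun i k hik => ?_⟩
  · rw [← translate_translate t A, mem_translate, hmem]
    refine exists_congr fun i => ⟨fun h => ?_, fun h => ?_⟩
    · change o i ^^^ t = v
      rw [h, xor_xor_self]
    · rw [← h, xor_xor_self]
  · rw [← hadj i k hik, Adj, Adj]
    simp only [pt_xor ht, Nat.xor_left_inj, ne_eq]

namespace Good

variable {A : Finset ℕ} (hA : Good A)
include hA

theorem exists_rooted {j : ℕ} (hj : column A = j) (h₀ : 64 * j ∈ A) :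
    ∃ l ∈ leaves j, Rooted j l ∧ l.toFinset = A := by
  obtain ⟨l, hl, -, rfl⟩ := hA.exists_mem_leaves h₀ fun v hv => by
    have := column_le hv
    omega
  have := hA.1 _ h₀
  exact ⟨l, hl, rooted_of_mem_leaves (by omega) hl, rfl⟩

theorem exists_mem_column : ∃ y < 64, 64 * column A + y ∈ A := by
  have hne : A.Nonempty := Finset.card_pos.1 (by rw [hA.2.1]; norm_num)
  obtain ⟨v, hv⟩ := hne
  obtain ⟨w, hw, hw'⟩ : ∃ w ∈ A, w / 64 = column A :=
    Nat.sInf_mem (s := {j | ∃ v ∈ A, v / 64 = j}) ⟨_, v, hv, rfl⟩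
  refine ⟨w % 64, Nat.mod_lt _ (by norm_num), ?_⟩
  rwa [← hw', Nat.div_add_mod]

theorem column_lt : column A < 32 := by
  obtain ⟨y, -, h⟩ := hA.exists_mem_column
  have := hA.1 _ h
  omega

theorem exists_rooted_translate : ∃ y < 64, ∃ l, Rooted (column A) l ∧
    l.toFinset = AbsorptionSearch.translate y A := by
  obtain ⟨y, hy, h⟩ := hA.exists_mem_column
  obtain ⟨l, -, hl, e⟩ := (hA.translate hy).exists_rooted (column_translate hy A) <| by
    rw [mem_translate, ← Nat.add_zero (64 * _), mul_add_xor (by norm_num) hy, Nat.zero_xor]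
    exact h
  exact ⟨y, hy, l, hl, e⟩

theorem arrangeable : Arrangeable A := by
  obtain ⟨y, hy, l, hl, e⟩ := hA.exists_rooted_translate
  exact .of_translate hy (e ▸ hl.arrangeable)

/-- The search shows that the least column holds one or two elements, so the integer quotient is an
exact weight. -/
theorem columnCard_mul : columnCard (column A) A * (2 / columnCard (column A) A) = 2 := by
  obtain ⟨y, hy, l, hl, e⟩ := hA.exists_rooted_translate
  have h2 := hl.columnCard_le
  rw [e, columnCard_translate hy] at h2
  have h1 : 0 < columnCard (column A) A := by
    obtain ⟨z, hz, h⟩ := hA.exists_mem_column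
    exact Finset.card_pos.2 ⟨_, Finset.mem_filter.2 ⟨h, by omega⟩⟩
  interval_cases columnCard (column A) A <;> rfl

end Good

/-! ## The number of absorption sets -/

theorem finite_good (j : ℕ) : {A : Finset ℕ | Good A ∧ column A = j}.Finite :=
  (Finset.range 2048).powerset.finite_toSet.subset fun _ hA =>
    Finset.mem_powerset.2 fun v hv => Finset.mem_range.2 (hA.1.1 v hv)

/-- The `(8, 8)` absorption sets with least block column `j`. -/
noncomputable def goodSets (j : ℕ) : Finset (Finset ℕ) := (finite_good j).toFinset

theorem mem_goodSets {j : ℕ} {A : Finset ℕ} : A ∈ goodSets j ↔ Good A ∧ column A = j :=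
  (finite_good j).mem_toFinset

theorem key_mod_four (j : ℕ) (l : List ℕ) : key j l % 4 = 2 / inColumn j l := by
  change (4 * bits l + 2 / inColumn j l) % 4 = _
  have : 2 / inColumn j l ≤ 2 := Nat.div_le_self _ _
  generalize 2 / inColumn j l = r at *
  omega

theorem key_div_four (j : ℕ) (l : List ℕ) : key j l / 4 = bits l := by
  change (4 * bits l + 2 / inColumn j l) / 4 = _
  have : 2 / inColumn j l ≤ 2 := Nat.div_le_self _ _
  generalize 2 / inColumn j l = r at *
  omega

theorem key_congr {j : ℕ} {l m : List ℕ} (hl : l.Nodup) (hm : m.Nodup)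
    (h : l.toFinset = m.toFinset) : key j l = key j m := by
  rw [key, key, bits_eq_bits_iff.2 h, inColumn_eq hl, inColumn_eq hm, h]

/-- A set may be found several times and in several orders; the key depends only on the set, so
removing duplicates leaves one weight for each. -/
theorem rootCount_eq_sum {j : ℕ} (hj : j < 32) :
    rootCount j = ∑ A ∈ (goodSets j).filter (64 * j ∈ ·), 2 / columnCard j A := by
  have e : (((leaves j).map (key j)).dedup).toFinset =
      ((goodSets j).filter (64 * j ∈ ·)).image fun A => key j A.toList := by
    ext a
    rw [List.mem_toFinset, List.mem_dedup, List.mem_map, Finset.mem_image]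
    constructor
    · rintro ⟨l, hl, rfl⟩
      have hr := rooted_of_mem_leaves hj hl
      refine ⟨l.toFinset, Finset.mem_filter.2 ⟨mem_goodSets.2 ⟨hr.good, ?_⟩,
        List.mem_toFinset.2 hr.mem⟩, key_congr (Finset.nodup_toList _) hr.nodup (by simp)⟩
      obtain ⟨y, hy, h⟩ := hr.good.exists_mem_column
      have h1 := hr.le _ (List.mem_toFinset.1 h)
      have h2 := column_le (List.mem_toFinset.2 hr.mem)
      omega
    · rintro ⟨A, hA, rfl⟩
      obtain ⟨hA, h₀⟩ := Finset.mem_filter.1 hA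
      obtain ⟨hA, hcol⟩ := mem_goodSets.1 hA
      obtain ⟨l, hl, hr, rfl⟩ := hA.exists_rooted hcol h₀
      exact ⟨l, hl, key_congr hr.nodup (Finset.nodup_toList _) (by simp)⟩
  change (((leaves j).map (key j)).dedup.map fun a => a % 4).sum = _
  rw [← List.sum_toFinset _ (List.nodup_dedup _), e, Finset.sum_image]
  · refine Finset.sum_congr rfl fun A _ => ?_
    rw [key_mod_four, inColumn_eq (Finset.nodup_toList _), Finset.toList_toFinset]
  · intro A _ B _ h
    have := congrArg (· / 4) h
    simp only [key_div_four] at this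
    simpa using bits_eq_bits_iff.1 this

theorem sum_filter_mem {j y : ℕ} (hy : y < 64) :
    ∑ A ∈ (goodSets j).filter (64 * j + y ∈ ·), 2 / columnCard j A =
      ∑ A ∈ (goodSets j).filter (64 * j ∈ ·), 2 / columnCard j A := by
  have h (a b : ℕ) (ha : a < 64) (hab : a ^^^ y = b) (A : Finset ℕ)
      (hA : A ∈ (goodSets j).filter (64 * j + b ∈ ·)) :
      translate y A ∈ (goodSets j).filter (64 * j + a ∈ ·) := by
    obtain ⟨hA, hmem⟩ := Finset.mem_filter.1 hA
    obtain ⟨hA, hcol⟩ := mem_goodSets.1 hA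
    refine Finset.mem_filter.2 ⟨mem_goodSets.2 ⟨hA.translate hy, ?_⟩, ?_⟩
    · rw [column_translate hy, hcol]
    · rwa [mem_translate, mul_add_xor ha hy, hab]
  exact Finset.sum_nbij' (translate y) (translate y) (h 0 y (by norm_num) (Nat.zero_xor y))
    (h y 0 hy (Nat.xor_self y)) (fun A _ => translate_translate y A)
    (fun A _ => translate_translate y A) fun A _ => by rw [columnCard_translate hy]

theorem columnCard_eq_sum (j : ℕ) (A : Finset ℕ) :
    columnCard j A = ∑ y ∈ Finset.range 64, if 64 * j + y ∈ A then 1 else 0 := by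
  rw [← Finset.card_filter, columnCard]
  refine Finset.card_nbij' (· % 64) (64 * j + ·) ?_ ?_ ?_ ?_
  · intro v hv
    obtain ⟨hv, rfl⟩ := Finset.mem_filter.1 hv
    exact Finset.mem_filter.2 ⟨Finset.mem_range.2 (Nat.mod_lt _ (by norm_num)),
      by rwa [Nat.div_add_mod]⟩
  · intro y hy
    obtain ⟨hy, h⟩ := Finset.mem_filter.1 hy
    have := Finset.mem_range.1 hy
    refine Finset.mem_filter.2 ⟨h, ?_⟩
    change (64 * j + y) / 64 = j
    omega
  · intro v hv
    obtain ⟨hv, rfl⟩ := Finset.mem_filter.1 hv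
    exact Nat.div_add_mod _ _
  · intro y hy
    have := Finset.mem_range.1 (Finset.mem_filter.1 hy).1
    change (64 * j + y) % 64 = y
    omega

/-- Each set distributes a total weight of `2` equally over its elements in column `j`. Every one of
the `64` positions collects the same total, `rootCount j`, by translation. -/
theorem card_goodSets {j : ℕ} (hj : j < 32) : (goodSets j).card * 2 = 64 * rootCount j := by
  have h1 : ∑ A ∈ goodSets j, 2 = ∑ A ∈ goodSets j, columnCard j A * (2 / columnCard j A) := by
    refine Finset.sum_congr rfl fun A hA => ?_
    obtain ⟨hgood, rfl⟩ := mem_goodSets.1 hA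
    exact hgood.columnCard_mul.symm
  rw [← smul_eq_mul, ← Finset.sum_const, h1]
  have h2 (A : Finset ℕ) : columnCard j A * (2 / columnCard j A) =
      ∑ y ∈ Finset.range 64, if 64 * j + y ∈ A then 2 / columnCard j A else 0 := by
    generalize 2 / columnCard j A = r
    rw [columnCard_eq_sum, Finset.sum_mul]
    simp only [ite_mul, one_mul, zero_mul]
  rw [Finset.sum_congr rfl fun A _ => h2 A, Finset.sum_comm, rootCount_eq_sum hj]
  simp only [← Finset.sum_filter]
  rw [Finset.sum_congr rfl fun y hy => sum_filter_mem (Finset.mem_range.1 hy)]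
  simp

theorem ncard_good : {A : Finset ℕ | Good A}.ncard = 14272 := by
  have e : {A : Finset ℕ | Good A} = ((Finset.range 32).biUnion goodSets : Finset _) := by
    ext A
    simp only [Set.mem_ofPred_eq, Finset.mem_coe, Finset.mem_biUnion, Finset.mem_range, mem_goodSets]
    exact ⟨fun h => ⟨_, h.column_lt, h, rfl⟩, fun ⟨_, _, h, _⟩ => h⟩
  rw [e, Set.ncard_coe_finset, Finset.card_biUnion]
  · have h : (∑ j ∈ Finset.range 32, (goodSets j).card) * 2 = 14272 * 2 := by
      rw [Finset.sum_mul, Finset.sum_congr rfl fun j hj => by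
        rw [card_goodSets (Finset.mem_range.1 hj), rootCount_eq (Finset.mem_range.1 hj)]]
      -- The root counts add up to `446`, and `64 * 446 = 2 * 14272`.
      decide
    omega
  · intro i _ j _ hij
    refine Finset.disjoint_left.2 fun A hi hj => hij ?_
    rw [← (mem_goodSets.1 hi).2, (mem_goodSets.1 hj).2]

/-! ## Transport to the parity-check matrix -/

theorem sh_eq_blockShift (i : Fin 6) (j : Fin 32) : sh i j = blockShift i j := by
  revert i j
  decide +kernel

/-- The number of the variable node in the given position. -/
def index (p : Fin 32 × Fin 64) : ℕ := 64 * p.1 + p.2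

theorem index_injective : Function.Injective index := by
  rintro ⟨j, y⟩ ⟨k, z⟩ h
  simp only [index] at h
  exact Prod.ext (Fin.ext (by simp only; omega)) (Fin.ext (by simp only; omega))

theorem index_lt (p : Fin 32 × Fin 64) : index p < 2048 := by
  unfold index
  omega

theorem exists_index_eq {v : ℕ} (hv : v < 2048) : ∃ p, index p = v :=
  ⟨(⟨v / 64, by omega⟩, ⟨v % 64, Nat.mod_lt _ (by norm_num)⟩), Nat.div_add_mod v 64⟩

theorem blocks_eq_one_iff (c : Fin 6 × Fin 64) (p : Fin 32 × Fin 64) :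
    ieee8023anBlocks c p = 1 ↔ pt c.1 (index p) = c.2 := by
  have h1 : index p / 64 = p.1 := by
    unfold index
    omega
  have h2 : index p % 64 = p.2 := by
    unfold index
    omega
  rw [pt_eq, h1, h2, sh_eq_blockShift, ieee8023anBlocks]
  split_ifs with h
  · exact ⟨fun _ => h.symm, fun _ => rfl⟩
  · exact ⟨fun h' => absurd h' zero_ne_one, fun h' => absurd h'.symm h⟩

section

variable (r : Fin 384 ≃ Fin 6 × Fin 64) (s : Fin 2048 ≃ Fin 32 × Fin 64)

/-- The numbers of the variable nodes, in the numbering `s` of the columns. -/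
def numbering : Fin 2048 ↪ ℕ := ⟨fun v => index (s v), index_injective.comp s.injective⟩

theorem numbering_lt (v : Fin 2048) : numbering s v < 2048 := index_lt (s v)

theorem exists_numbering_eq {v : ℕ} (hv : v < 2048) : ∃ i, numbering s i = v := by
  obtain ⟨p, rfl⟩ := exists_index_eq hv
  exact ⟨s.symm p, congrArg index (s.apply_symm_apply p)⟩

theorem submatrix_eq_one_iff (c : Fin 384) (v : Fin 2048) :
    ieee8023anBlocks.submatrix r s c v = 1 ↔ pt (r c).1 (numbering s v) = (r c).2 :=
  blocks_eq_one_iff (r c) (s v)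

theorem connections_eq (A : Finset (Fin 2048)) (c : Fin 384) :
    connections (ieee8023anBlocks.submatrix r s) A c =
      mult (A.map (numbering s)) (r c).1 (r c).2 := by
  rw [connections, mult, Finset.filter_map, Finset.card_map]
  simp only [submatrix_eq_one_iff]
  rfl

theorem card_filter_neighborChecks (v : Fin 2048) (p : ℕ → ℕ → Prop)
    [∀ x z, Decidable (p x z)] :
    ((neighborChecks (ieee8023anBlocks.submatrix r s) v).filter fun c =>
      p (r c).1 (r c).2).card =
    ((Finset.range 6).filter fun x => p x (pt x (numbering s v))).card := by
  refine Finset.card_bij (fun c _ => (r c).1) ?_ ?_ ?_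
  · intro c hc
    obtain ⟨hc, hp⟩ := Finset.mem_filter.1 hc
    have := (submatrix_eq_one_iff r s c v).1 (Finset.mem_filter.1 hc).2
    exact Finset.mem_filter.2 ⟨Finset.mem_range.2 (r c).1.2, this ▸ hp⟩
  · intro c hc c' hc' h
    have h1 := (submatrix_eq_one_iff r s c v).1 (Finset.mem_filter.1 (Finset.mem_filter.1 hc).1).2
    have h2 := (submatrix_eq_one_iff r s c' v).1 (Finset.mem_filter.1 (Finset.mem_filter.1 hc').1).2
    rw [h, h2] at h1
    exact r.injective (Prod.ext (Fin.ext h) (Fin.ext h1.symm))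
  · intro x hx
    obtain ⟨hx, hp⟩ := Finset.mem_filter.1 hx
    set c := r.symm (⟨x, Finset.mem_range.1 hx⟩, ⟨pt x (numbering s v), pt_lt _ _⟩) with hcdef
    have hc : r c = (⟨x, Finset.mem_range.1 hx⟩, ⟨pt x (numbering s v), pt_lt _ _⟩) :=
      r.apply_symm_apply _
    refine ⟨c, Finset.mem_filter.2 ⟨Finset.mem_filter.2 ⟨Finset.mem_univ _, ?_⟩, ?_⟩, ?_⟩
    · rw [submatrix_eq_one_iff, hc]
    · rwa [hc]
    · rw [hc]

theorem card_neighborChecks (v : Fin 2048) :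
    (neighborChecks (ieee8023anBlocks.submatrix r s) v).card = 6 := by
  have := card_filter_neighborChecks r s v fun _ _ => True
  simpa using this

theorem extrinsicMessageDegree_eq (A : Finset (Fin 2048)) :
    extrinsicMessageDegree (ieee8023anBlocks.submatrix r s) A = ∑ x ∈ Finset.range 6,
      ((Finset.range 64).filter fun z => Odd (mult (A.map (numbering s)) x z)).card := by
  simp only [extrinsicMessageDegree, connections_eq, Finset.card_filter]
  refine (Equiv.sum_comp r fun c : Fin 6 × Fin 64 =>
    if Odd (mult (A.map (numbering s)) c.1 c.2) then 1 else 0).trans ?_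
  simp only [Fintype.sum_prod_type, Finset.sum_range]

theorem isABAbsorptionSet_iff (A : Finset (Fin 2048)) :
    IsABAbsorptionSet (ieee8023anBlocks.submatrix r s) 8 8 A ↔ Good (A.map (numbering s)) := by
  rw [IsABAbsorptionSet, Good, extrinsicMessageDegree_eq, Finset.card_map,
    and_iff_right (a := ∀ v ∈ A.map (numbering s), v < 2048), IsAbsorptionSet, and_left_comm]
  · refine and_congr_right fun _ => and_congr_left fun _ => ?_
    rw [Finset.forall_mem_map]
    refine forall₂_congr fun v _ => ?_
    simp only [connections_eq]
    rw [card_neighborChecks, card_filter_neighborChecks r s v fun x z =>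
      Even (mult (A.map (numbering s)) x z)]
    -- A strict majority of six checks means at least four.
    omega
  · rw [Finset.forall_mem_map]
    exact fun v _ => numbering_lt s v

theorem ncard_absorptionSets :
    {A | IsABAbsorptionSet (ieee8023anBlocks.submatrix r s) 8 8 A}.ncard = 14272 := by
  rw [← ncard_good, ← Set.ncard_image_of_injective _ (Finset.map_injective (numbering s))]
  congr 1
  ext A
  simp only [Set.mem_image, Set.mem_ofPred_eq, isABAbsorptionSet_iff]
  constructor
  · rintro ⟨B, hB, rfl⟩
    exact hB
  · intro hA
    refine ⟨A.preimage (numbering s) (numbering s).injective.injOn, ?_⟩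
    have e : (A.preimage (numbering s) (numbering s).injective.injOn).map (numbering s) = A := by
      ext v
      rw [Finset.mem_map]
      constructor
      · rintro ⟨i, hi, rfl⟩
        exact Finset.mem_preimage.1 hi
      · intro hv
        obtain ⟨i, rfl⟩ := exists_numbering_eq s (hA.1 v hv)
        exact ⟨i, Finset.mem_preimage.2 hv, rfl⟩
    exact ⟨by rwa [e], e⟩

theorem hasTopology {A : Finset (Fin 2048)} (hA : Good (A.map (numbering s))) :
    HasTopology (ieee8023anBlocks.submatrix r s) A topology88 := by
  refine ⟨fun c => ?_, ?_⟩
  · rw [connections_eq]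
    exact hA.mult_le_two (r c).1.2 (r c).2.2
  obtain ⟨o, hinj, hmem, hadj⟩ := hA.arrangeable
  have h (i : Fin 8) : ∃ v : {v // v ∈ A}, numbering s v = o i := by
    obtain ⟨v, hv, e⟩ := Finset.mem_map.1 ((hmem (o i)).2 ⟨i, rfl⟩)
    exact ⟨⟨v, hv⟩, e⟩
  choose g hg using h
  have hbij : Function.Bijective g := by
    refine ⟨fun i k hik => hinj ?_, fun v => ?_⟩
    · rw [← hg, hik, hg]
    · obtain ⟨i, hi⟩ := (hmem _).1 (Finset.mem_map_of_mem (numbering s) v.2)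
      refine ⟨i, Subtype.ext ((numbering s).injective ?_)⟩
      rw [hg, hi]
  refine ⟨(Equiv.ofBijective g hbij).symm, fun u v huv => ?_⟩
  obtain ⟨i, rfl⟩ := hbij.2 u
  obtain ⟨k, rfl⟩ := hbij.2 v
  have hik : i ≠ k := fun h => huv (congrArg g h)
  have hsymm (i : Fin 8) : (Equiv.ofBijective g hbij).symm (g i) = i :=
    (Equiv.ofBijective g hbij).symm_apply_apply i
  rw [hsymm, hsymm, ← hadj i k hik]
  simp only [submatrix_eq_one_iff, hg]
  have hlt (i : Fin 8) : o i < 2048 := hg i ▸ numbering_lt s _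
  constructor
  · rintro ⟨hne, x, hx, hxo⟩
    refine ⟨r.symm (⟨x, hx⟩, ⟨pt x (o i), pt_lt _ _⟩), ?_, fun c hc => ?_⟩
    · simp only [Equiv.apply_symm_apply]
      exact ⟨trivial, hxo.symm⟩
    -- Uniqueness of the common check is the absence of `4`-cycles.
    · have hcx := eq_of_pt_eq (hlt i) (hlt k) (r c).1.2 hx hne (hc.1.trans hc.2.symm) hxo
      rw [Equiv.eq_symm_apply]
      refine Prod.ext (Fin.ext hcx) (Fin.ext ?_)
      rw [← hc.1, hcx]
  · rintro hn ⟨c, h₁, h₂⟩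
    exact hn ⟨hinj.ne hik, _, (r c).1.2, h₁.trans h₂.symm⟩

end

end AbsorptionSearch

theorem mainTheorem1 (H : Matrix (Fin 384) (Fin 2048) (ZMod 2)) (hH : IsIEEE8023anMatrix H) :
    {A : Finset (Fin 2048) | IsABAbsorptionSet H 8 8 A}.ncard = 14272 ∧
    ∀ A : Finset (Fin 2048), IsABAbsorptionSet H 8 8 A → HasTopology H A topology88 := by
  obtain ⟨r, s, rfl⟩ := hH
  exact ⟨AbsorptionSearch.ncard_absorptionSets r s, fun A hA =>
    AbsorptionSearch.hasTopology r s ((AbsorptionSearch.isABAbsorptionSet_iff r s A).1 hA)⟩
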